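/- Write $(z_1,\dots,z_n,w)$ for the coordinates of $\mathbb C^{n+1}$. For a smooth real hypersurface $M\subset\mathbb C^{N}$ with local defining function $r$ near $p\in M$, let $\Gamma$ be the set of germs of nonconstant holomorphic maps $\gamma:(\mathbb C,0)\to(\mathbb C^{N},p)$, let $\mathrm{ord}$ denote the order of vanishing at $0$, and put $$\Delta_1(M,p)=\sup_{\gamma\in\Gamma}\frac{\mathrm{ord}(r\circ\gamma)}{\mathrm{ord}(\gamma-p)},\qquad \Delta_1^{\rm reg}(M,p)=\sup\{\mathrm{ord}(r\circ\gamma):\gamma\in\Gamma,\ \mathrm{ord}(\gamma-p)=1\}.$$ A curve $\gamma\in\Gamma$ is tangent to $M$ at $p$ to infinite order if $r(\gamma(t))=O(|t|^m)$ as $t\to0$ for every $m\in\mathbb N$. The hypersurface $M\subset\mathbb C^{n+1}$ is of Bloom–Graham finite type at $p$ if the orders of contact with $M$ at $p$ of $n$-dimensional complex submanifolds through $p$ are bounded. **Theorem.** Let $n\ge 2$. There is a smooth pseudoconvex real hypersurface $M\subset\mathbb C^{n+1}$ containing $p=0$ such that $\Delta_1(M,p)=\infty$ and $\Delta_1^{\rm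 reg}(M,p)<\infty$, such that $M$ is of Bloom–Graham finite type at $p$, and such that no $\gamma\in\Gamma$ is tangent to $M$ at $p$ to infinite order. More precisely, there are a strictly increasing sequence $(c_j)$ of positive real numbers such that $\sum_j c_jz^j$ converges absolutely for no $z\ne0$ (equivalently, has radius of convergence $0$), and a smooth subharmonic function $f:\mathbb C\to\mathbb R$ with Taylor series $2\sum_{j\ge 8}\mathrm{Re}(c_jz^j)$ at the origin, such that $$M=\Big\{(z,w)\in\mathbb C^{n}\times\mathbb C:\ 2\,\mathrm{Re}(w)+|z_1^3-z_2^2|^2+f(z_1)+\sum_{j=3}^n|z_j|^2=0\Big\}$$ has all these properties. -/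

import Mathlib

open Filter Topology Asymptotics
open scoped ContDiff ENNReal

noncomputable section

/-- The order of vanishing at the origin of a (smooth) map `h`: the supremum of all `m` with
`h x = O(‖x‖ ^ m)` as `x → 0`. It is `⊤` exactly when `h` vanishes to infinite order. -/
def vanishingOrder {V W : Type*} [NormedAddCommGroup V] [NormedAddCommGroup W]
    (h : V → W) : ℕ∞ :=
  ⨆ (m : ℕ) (_ : h =O[𝓝 0] fun x => ‖x‖ ^ m), (m : ℕ∞)

/-- `r` is a smooth defining function of `M ⊆ ℂ^N` on the open set `U`:
`M ∩ U = {z ∈ U | r z = 0}` and the differential of `r` does not vanish on `M ∩ U`. -/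
def IsDefiningFunction {N : ℕ} (M U : Set (Fin N → ℂ)) (r : (Fin N → ℂ) → ℝ) : Prop :=
  IsOpen U ∧ ContDiffOn ℝ ∞ r U ∧ (∀ z ∈ U, z ∈ M ↔ r z = 0) ∧
    ∀ z ∈ M ∩ U, fderiv ℝ r z ≠ 0

/-- `r` is a smooth local defining function of `M` near `p`. -/
def IsLocalDefiningFunction {N : ℕ} (M : Set (Fin N → ℂ)) (p : Fin N → ℂ)
    (r : (Fin N → ℂ) → ℝ) : Prop :=
  ∃ U : Set (Fin N → ℂ), p ∈ U ∧ IsDefiningFunction M U r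

/-- `M` is a `C^∞` smooth real hypersurface of `ℂ^N`. -/
def IsSmoothRealHypersurface {N : ℕ} (M : Set (Fin N → ℂ)) : Prop :=
  ∀ p ∈ M, ∃ r : (Fin N → ℂ) → ℝ, IsLocalDefiningFunction M p r

/-- The Wirtinger derivative `∂g/∂z_j = (∂g/∂x_j - i ∂g/∂y_j) / 2`. -/
def wirtinger {N : ℕ} (j : Fin N) (g : (Fin N → ℂ) → ℂ) (z : Fin N → ℂ) : ℂ :=
  (1 / 2) * (fderiv ℝ g z (Pi.single j 1) - Complex.I * fderiv ℝ g z (Pi.single j Complex.I))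

/-- The Wirtinger derivative `∂g/∂z̄_j = (∂g/∂x_j + i ∂g/∂y_j) / 2`. -/
def wirtingerBar {N : ℕ} (j : Fin N) (g : (Fin N → ℂ) → ℂ) (z : Fin N → ℂ) : ℂ :=
  (1 / 2) * (fderiv ℝ g z (Pi.single j 1) + Complex.I * fderiv ℝ g z (Pi.single j Complex.I))

/-- `v` is a complex tangent vector of type (1,0) at `z` to the level set of `r` through `z`:
`∑ j, ∂r/∂z_j (z) v_j = 0`. -/
def IsComplexTangent {N : ℕ} (r : (Fin N → ℂ) → ℝ) (z v : Fin N → ℂ) : Prop :=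
  ∑ j : Fin N, wirtinger j (fun x => (r x : ℂ)) z * v j = 0

/-- The (real valued) Levi form `∑ j k, ∂²r/∂z_j∂z̄_k (z) v_j v̄_k`. -/
def leviForm {N : ℕ} (r : (Fin N → ℂ) → ℝ) (z v : Fin N → ℂ) : ℝ :=
  (∑ j : Fin N, ∑ k : Fin N,
    wirtinger j (wirtingerBar k (fun x => (r x : ℂ))) z * v j * star (v k)).re

/-- `M` is a pseudoconvex hypersurface: it has a smooth defining function in a neighbourhood of `M`
whose Levi form is nonnegative on all complex tangent vectors at all points of `M`. -/
def IsPseudoconvexHypersurface {N : ℕ} (M : Set (Fin N → ℂ)) : Prop :=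
  ∃ (U : Set (Fin N → ℂ)) (r : (Fin N → ℂ) → ℝ), M ⊆ U ∧ IsDefiningFunction M U r ∧
    ∀ z ∈ M, ∀ v : Fin N → ℂ, IsComplexTangent r z v → 0 ≤ leviForm r z v

/-- The (representatives of) germs of nonconstant holomorphic maps `γ : (ℂ, 0) → (ℂ^N, p)`. -/
def holomorphicCurves {N : ℕ} (p : Fin N → ℂ) : Set (ℂ → Fin N → ℂ) :=
  {γ | AnalyticAt ℂ γ 0 ∧ γ 0 = p ∧ ¬ ∀ᶠ t in 𝓝 (0 : ℂ), γ t = p}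

/-- The order of contact `ord (r ∘ φ)` at `p` of a map germ `φ : (V, 0) → (ℂ^N, p)` with the
hypersurface `M`. The order is the same for all local defining functions `r` of `M` near `p`;
the supremum over `r` is this common value. -/
def contactOrder {N : ℕ} {V : Type*} [NormedAddCommGroup V] (M : Set (Fin N → ℂ))
    (p : Fin N → ℂ) (φ : V → Fin N → ℂ) : ℕ∞ :=
  ⨆ (r : (Fin N → ℂ) → ℝ) (_ : IsLocalDefiningFunction M p r), vanishingOrder (r ∘ φ)

/-- The D'Angelo type `Δ₁(M, p) = sup_γ ord (r ∘ γ) / ord (γ - p)`. -/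
def dangeloType {N : ℕ} (M : Set (Fin N → ℂ)) (p : Fin N → ℂ) : ℝ≥0∞ :=
  ⨆ γ ∈ holomorphicCurves p,
    ((contactOrder M p γ : ℕ∞) : ℝ≥0∞) / ((vanishingOrder fun t => γ t - p : ℕ∞) : ℝ≥0∞)

/-- The regular type `Δ₁^reg(M, p) = sup_γ ord (r ∘ γ)`, over the curves with `ord (γ - p) = 1`. -/
def regularType {N : ℕ} (M : Set (Fin N → ℂ)) (p : Fin N → ℂ) : ℕ∞ :=
  ⨆ γ ∈ {γ ∈ holomorphicCurves p | vanishingOrder (fun t => γ t - p) = 1}, contactOrder M p γ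

/-- The Bloom–Graham type of `M ⊆ ℂ^(n+1)` at `p`: the supremum of the orders of contact with `M`
at `p` of `n`-dimensional complex submanifolds `X` through `p`, where the germ of `X` at `p` is
given by a parametrization, i.e. the germ of a holomorphic immersion `φ : (ℂ^n, 0) → (ℂ^(n+1), p)`.
The type is `⊤` if arbitrarily high orders of contact occur. -/
def bloomGrahamType {n : ℕ} (M : Set (Fin (n + 1) → ℂ)) (p : Fin (n + 1) → ℂ) : ℕ∞ :=
  ⨆ φ ∈ {φ : (Fin n → ℂ) → Fin (n + 1) → ℂ |
      AnalyticAt ℂ φ 0 ∧ φ 0 = p ∧ Function.Injective (fderiv ℂ φ 0)}, contactOrder M p φ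

/-- `γ` is tangent to `M` at `p` to infinite order: `r (γ t) = O(t ^ m)` as `t → 0` for every `m`,
where `r` is a local defining function of `M` near `p`. -/
def IsTangentToInfiniteOrder {N : ℕ} (M : Set (Fin N → ℂ)) (p : Fin N → ℂ)
    (γ : ℂ → Fin N → ℂ) : Prop :=
  ∃ r : (Fin N → ℂ) → ℝ, IsLocalDefiningFunction M p r ∧
    ∀ m : ℕ, (r ∘ γ) =O[𝓝 0] fun t => ‖t‖ ^ m

/-- A smooth function on `ℂ` is subharmonic if its Laplacian is nonnegative. -/
def IsSmoothSubharmonic (f : ℂ → ℝ) : Prop :=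
  ContDiff ℝ ∞ f ∧ ∀ z : ℂ, 0 ≤ Laplacian.laplacian f z

/-- The function `f` has the Taylor series `2 ∑_{j ≥ 8} Re (c_j z ^ j)` at the origin. -/
def HasTaylorSeriesRe (f : ℂ → ℝ) (c : ℕ → ℝ) : Prop :=
  ∀ m : ℕ, (fun z : ℂ => f z - 2 * ∑ j ∈ Finset.Ico 8 m, ((c j : ℂ) * z ^ j).re)
    =O[𝓝 0] fun z => ‖z‖ ^ m

/-- The function `2 Re w + |z₁³ - z₂²|² + f(z₁) + ∑_{j=3}^n |z_j|²` on `ℂ^(n+1)` (for `n ≥ 2`),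
where the coordinates `z₁, …, z_n, w` have the indices `0, …, n - 1, n`. -/
def exampleFunction (n : ℕ) (f : ℂ → ℝ) (x : Fin (n + 1) → ℂ) : ℝ :=
  2 * (x (Fin.last n)).re + ‖x 0 ^ 3 - x 1 ^ 2‖ ^ 2 + f (x 0) +
    ∑ j : Fin (n + 1), if 2 ≤ j.val ∧ j.val < n then ‖x j‖ ^ 2 else 0

end

/-!
The hypersurface is cut out by `r = 2 Re w + |z₁ ^ 3 - z₂ ^ 2| ^ 2 + f(z₁) + ∑ |z_j| ^ 2`, where
`f` is subharmonic and has a *divergent* Taylor series `2 ∑ Re (c_j z ^ j)`.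

**The function `f`.** Let `P` be `2 Re (z ^ 8 / (1 - z))`, cut off outside a disc about `0`
(`profile`). The sum `∑ weight k * P (scale k * z)` of dilated copies of `P` has the Taylor
coefficients `c_j = ∑ weight k * scale k ^ j`; as `scale k → ∞`, the radius of convergence is `0`
for any positive weights. The `k`-th copy is harmonic for `|z| < 1 / (2 scale k)`, so the choice
`weight k = exp (-5 scale k ^ 2)` makes the Laplacian of the sum `O(exp (-1 / |z| ^ 2))` on the
whole plane (`exists_bound_laplacian_profileSum`). A multiple of the flat radial function
`flatRadial`, whose Laplacian is at least `4 exp (-1 / |z| ^ 2)`, restores subharmonicity without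
touching the Taylor series.

**Pseudoconvexity.** The Levi form of `r` at `z` in direction `v` is a quarter of the Laplacian of
`t ↦ r (z + t v)` (`leviForm_eq_laplacian`), and along every complex line `r` is a sum of
subharmonic functions.

**Orders of contact.** All local defining functions at `0` dominate `r`
(`isBigO_of_vanish_on_zeroSet`), so upper bounds on contact orders only concern `r`. If `r ∘ γ =
O(|t| ^ m)`, then up to this order `r ∘ γ` is the real part of the holomorphic germ `H = 2 (w +
∑_{j < m} c_j z₁ ^ j)` plus a sum of squared moduli. On a ray on which the leading term of `H` is
positive nothing can cancel (`exists_ray_of_re_add_nonneg_isBigO`), so `z₁ ^ 3 - z₂ ^ 2`, the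
middle coordinates and `H` all vanish to high order separately.

* For `m = 8` this excludes regular curves: `w` and the middle coordinates vanish to order at
  least `2`, and `z₁ ^ 3 - z₂ ^ 2` has order at most `3` if `z₁` or `z₂` has order `1`. Hence the
  regular type is at most `7`. Every immersed submanifold contains a regular curve, so the same
  bound holds for the Bloom–Graham type.
* The curves `(t ^ 2, t ^ 3, 0, …, -∑_{j < m} c_j t ^ (2 j))` have multiplicity `2` and contact
  order at least `2 m`; hence the D'Angelo type is infinite.
* A curve tangent to infinite order would satisfy `w = -∑ c_j z₁ ^ j` as formal power series. If
  `z₁ = 0`, the curve is constant. Otherwise `z₁ = ζ ^ p` for a local coordinate `ζ`, and the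
  convergent Taylor series of `w` in `ζ` would be `-∑ c_j ζ ^ (p j)`
  (`exists_summable_of_formal_relation`).
-/

/-! ### Second derivatives and the Laplacian in the plane -/

lemma laplacian_eq_fderiv_fderiv (f : ℂ → ℝ) (z : ℂ) :
    Laplacian.laplacian f z =
      fderiv ℝ (fderiv ℝ f) z 1 1 + fderiv ℝ (fderiv ℝ f) z Complex.I Complex.I := by
  rw [InnerProductSpace.laplacian_eq_iteratedFDeriv_complexPlane]
  simp [iteratedFDeriv_two_apply]

/-- Squares of harmonic functions are subharmonic: `Δ (u ^ 2) = 2 u Δ u + 2 |∇ u| ^ 2`. -/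
lemma laplacian_sq_nonneg {u : ℂ → ℝ} {z : ℂ} (hu : ContDiff ℝ ∞ u)
    (h : Laplacian.laplacian u z = 0) : 0 ≤ Laplacian.laplacian (fun x => u x ^ 2) z := by
  have hd : Differentiable ℝ u := hu.differentiable (by simp)
  have hd' : Differentiable ℝ (fderiv ℝ u) :=
    (hu.fderiv_right (m := ∞) (by simp)).differentiable (by simp)
  have h1 : fderiv ℝ (fun x => u x ^ 2) = fun x => (2 * u x) • fderiv ℝ u x := by
    ext1 x
    rw [fderiv_fun_pow 2 (hd x)]
    simp [two_mul]
  have h2 : ∀ v, fderiv ℝ (fderiv ℝ (fun x => u x ^ 2)) z v v =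
      2 * u z * fderiv ℝ (fderiv ℝ u) z v v + 2 * (fderiv ℝ u z v) ^ 2 := by
    intro v
    rw [h1, fderiv_fun_smul ((hd z).const_mul 2) (hd' z), fderiv_const_mul (hd z)]
    simp
    ring
  rw [laplacian_eq_fderiv_fderiv] at h ⊢
  rw [h2, h2]
  have : 2 * u z * (fderiv ℝ (fderiv ℝ u) z 1 1 + fderiv ℝ (fderiv ℝ u) z Complex.I Complex.I)
    = 0 := by rw [h, mul_zero]
  nlinarith [sq_nonneg (fderiv ℝ u z 1), sq_nonneg (fderiv ℝ u z Complex.I)]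

/-- The trace of a bilinear form over the real basis `v`, `I * v` is `‖v‖ ^ 2` times its trace over
`1`, `I`; no symmetry is needed, since the mixed terms cancel. -/
lemma bilin_mul_add_bilin_mul_I (B : ℂ →L[ℝ] ℂ →L[ℝ] ℝ) (v : ℂ) :
    B v v + B (Complex.I * v) (Complex.I * v) =
      ‖v‖ ^ 2 * (B 1 1 + B Complex.I Complex.I) := by
  have h1 : v = v.re • (1 : ℂ) + v.im • Complex.I := by
    apply Complex.ext <;> simp
  have h2 : Complex.I * v = (-v.im) • (1 : ℂ) + v.re • Complex.I := by
    apply Complex.ext <;> simp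
  rw [h2, ← Complex.normSq_eq_norm_sq, Complex.normSq_apply]
  nth_rewrite 1 2 [h1]
  simp only [map_add, map_smul, add_apply, smul_apply, smul_eq_mul]
  ring

/-! ### A flat radial function with large Laplacian -/

/-- The primitive of `s ↦ exp (-1 / s)` (extended by zero to `s ≤ 0`) vanishing at `0`. -/
noncomputable def flatPrimitive (s : ℝ) : ℝ := ∫ x in (0 : ℝ)..s, expNegInvGlue x

lemma hasDerivAt_flatPrimitive (s : ℝ) : HasDerivAt flatPrimitive (expNegInvGlue s) s :=
  intervalIntegral.integral_hasDerivAt_right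
    ((expNegInvGlue.contDiff (n := 0)).continuous.intervalIntegrable _ _)
    ((expNegInvGlue.contDiff (n := 0)).continuous.stronglyMeasurableAtFilter _ _)
    (expNegInvGlue.contDiff (n := 0)).continuous.continuousAt

lemma contDiff_flatPrimitive : ContDiff ℝ ∞ flatPrimitive := by
  rw [contDiff_infty_iff_deriv]
  refine ⟨fun s => (hasDerivAt_flatPrimitive s).differentiableAt, ?_⟩
  rw [funext fun s => (hasDerivAt_flatPrimitive s).deriv]
  exact expNegInvGlue.contDiff (n := ⊤)

lemma abs_flatPrimitive_le {s : ℝ} (hs : 0 ≤ s) :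
    |flatPrimitive s| ≤ expNegInvGlue s * s := by
  have := intervalIntegral.norm_integral_le_of_norm_le_const (a := 0) (b := s)
    (f := expNegInvGlue) (C := expNegInvGlue s) (fun x hx => by
      rw [Set.uIoc_of_le hs] at hx
      rw [Real.norm_of_nonneg (expNegInvGlue.nonneg x)]
      exact expNegInvGlue.monotone hx.2)
  simpa [flatPrimitive, abs_of_nonneg hs] using this

lemma expNegInvGlue_le_factorial_mul_pow (m : ℕ) {s : ℝ} (hs : 0 ≤ s) :
    expNegInvGlue s ≤ m.factorial * s ^ m := by
  rcases hs.eq_or_lt with rfl | hs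
  · rw [expNegInvGlue.zero]; positivity
  · rw [expNegInvGlue, if_neg hs.not_ge, Real.exp_neg]
    have h := Real.pow_div_factorial_le_exp s⁻¹ (inv_nonneg.2 hs.le) m
    have hp : 0 < s⁻¹ ^ m / (m.factorial : ℝ) := by positivity
    calc (Real.exp s⁻¹)⁻¹ ≤ (s⁻¹ ^ m / (m.factorial : ℝ))⁻¹ := inv_anti₀ hp h
      _ = m.factorial * s ^ m := by rw [inv_div, inv_pow, div_inv_eq_mul]

/-- A smooth radial function on `ℂ`, flat at the origin, whose Laplacian is at least
`4 exp (-1 / ‖z‖ ^ 2)`. -/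
noncomputable def flatRadial (z : ℂ) : ℝ := flatPrimitive (‖z‖ ^ 2)

lemma contDiff_flatRadial : ContDiff ℝ ∞ flatRadial :=
  contDiff_flatPrimitive.comp (contDiff_norm_sq ℝ)

lemma flatRadial_isBigO (m : ℕ) : flatRadial =O[𝓝 0] fun z : ℂ => ‖z‖ ^ m := by
  have hball : ∀ᶠ z in 𝓝 (0 : ℂ), ‖z‖ < 1 := by
    filter_upwards [Metric.ball_mem_nhds (0 : ℂ) one_pos] with z hz using by simpa using hz
  refine IsBigO.of_bound m.factorial ?_
  filter_upwards [hball] with z hz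
  rw [norm_pow, norm_norm, Real.norm_eq_abs]
  have h1 := abs_flatPrimitive_le (sq_nonneg ‖z‖)
  have h2 := expNegInvGlue_le_factorial_mul_pow m (sq_nonneg ‖z‖)
  have h3 : (‖z‖ ^ 2) ^ m ≤ ‖z‖ ^ m := by
    rw [← pow_mul]
    exact pow_le_pow_of_le_one (norm_nonneg z) hz.le (by omega)
  have h4 : ‖z‖ ^ 2 ≤ 1 := by nlinarith [norm_nonneg z]
  calc |flatRadial z| ≤ expNegInvGlue (‖z‖ ^ 2) * ‖z‖ ^ 2 := h1
    _ ≤ expNegInvGlue (‖z‖ ^ 2) * 1 := by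
        gcongr
        exact expNegInvGlue.nonneg _
    _ ≤ m.factorial * (‖z‖ ^ 2) ^ m := by simpa using h2
    _ ≤ m.factorial * ‖z‖ ^ m := by gcongr

lemma le_laplacian_flatRadial (z : ℂ) :
    4 * expNegInvGlue (‖z‖ ^ 2) ≤ Laplacian.laplacian flatRadial z := by
  have hg : Differentiable ℝ expNegInvGlue :=
    (expNegInvGlue.contDiff (n := 1)).differentiable (by simp)
  obtain ⟨L, hL⟩ : ∃ L : ℂ →L[ℝ] ℂ →L[ℝ] ℝ, ∀ x, L x = innerSL ℝ x := ⟨innerSL ℝ, fun _ => rfl⟩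
  have h1 : fderiv ℝ flatRadial =
      fun x => (2 * expNegInvGlue (‖x‖ ^ 2)) • L x := by
    ext1 x
    have := (hasDerivAt_flatPrimitive (‖x‖ ^ 2)).comp_hasFDerivAt x
      (hasStrictFDerivAt_norm_sq x).hasFDerivAt
    refine this.fderiv.trans ?_
    ext v
    simp [hL]
    ring
  have h2 : HasFDerivAt (fderiv ℝ flatRadial)
      ((2 * expNegInvGlue (‖z‖ ^ 2)) • L +
        ((2 : ℝ) • (deriv expNegInvGlue (‖z‖ ^ 2)) •
          ((2 : ℕ) • L z)).smulRight (L z)) z := by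
    rw [h1]
    have ha : HasFDerivAt (fun x : ℂ => 2 * expNegInvGlue (‖x‖ ^ 2))
        ((2 : ℝ) • (deriv expNegInvGlue (‖z‖ ^ 2)) • ((2 : ℕ) • L z)) z :=
      ((hg _).hasDerivAt.comp_hasFDerivAt z
        (hL z ▸ (hasStrictFDerivAt_norm_sq z).hasFDerivAt)).const_mul 2
    exact ha.smul L.hasFDerivAt
  have h3 : ∀ v : ℂ, ‖v‖ = 1 →
      2 * expNegInvGlue (‖z‖ ^ 2) ≤ fderiv ℝ (fderiv ℝ flatRadial) z v v := by
    intro v hv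
    rw [h2.fderiv]
    have hpos : 0 ≤ deriv expNegInvGlue (‖z‖ ^ 2) := expNegInvGlue.monotone.deriv_nonneg
    have hvv : inner ℝ v v = (1 : ℝ) := by rw [real_inner_self_eq_norm_sq, hv]; norm_num
    simp only [add_apply, smul_apply, hL,
      ContinuousLinearMap.smulRight_apply, smul_eq_mul, innerSL_apply_apply, hvv]
    have : 0 ≤ deriv expNegInvGlue (‖z‖ ^ 2) * (inner ℝ z v * inner ℝ z v) :=
      mul_nonneg hpos (mul_self_nonneg _)
    simp only [nsmul_eq_mul]
    push_cast
    linarith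
  rw [laplacian_eq_fderiv_fderiv]
  have := h3 1 (by simp)
  have := h3 Complex.I (by simp)
  linarith

/-! ### The building block -/

/-- A smooth cutoff function on `ℂ`, equal to `1` on the disc of radius `1 / 2` and supported in
the disc of radius `3 / 4`. -/
noncomputable def discCutoff : ContDiffBump (0 : ℂ) := ⟨1 / 2, 3 / 4, by norm_num, by norm_num⟩

/-- The function `2 Re (z ^ 8 / (1 - z)) = 2 ∑_{j ≥ 8} Re (z ^ j)`, cut off away from its pole. -/
noncomputable def profile (z : ℂ) : ℝ := discCutoff z * (2 * (z ^ 8 / (1 - z)).re)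

lemma contDiff_profile : ContDiff ℝ ∞ profile := by
  rw [contDiff_iff_contDiffAt]
  intro z
  by_cases hz : z = 1
  · have h0 : profile =ᶠ[𝓝 z] fun _ => 0 := by
      have : ∀ᶠ y in 𝓝 z, 3 / 4 < ‖y‖ :=
        continuous_norm.continuousAt.eventually (lt_mem_nhds (by rw [hz]; norm_num))
      filter_upwards [this] with y hy
      have : discCutoff y = 0 := discCutoff.zero_of_le_dist (by simpa [discCutoff] using hy.le)
      simp [profile, this]
    exact contDiffAt_const.congr_of_eventuallyEq h0
  · have h1 : ContDiffAt ℝ ∞ (fun y : ℂ => y ^ 8 / (1 - y)) z :=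
      ContDiffAt.restrict_scalars ℝ (𝕜' := ℂ) <|
        ContDiffAt.div (by fun_prop) (by fun_prop) (sub_ne_zero.2 (Ne.symm hz))
    have h2 : ContDiffAt ℝ ∞ (fun y : ℂ => (y ^ 8 / (1 - y)).re) z :=
      Complex.reCLM.contDiff.contDiffAt.comp z h1
    exact discCutoff.contDiff.contDiffAt.mul (contDiffAt_const.mul h2)

lemma hasCompactSupport_profile : HasCompactSupport profile :=
  discCutoff.hasCompactSupport.mul_right

lemma profile_eq_of_norm_le {z : ℂ} (hz : ‖z‖ ≤ 1 / 2) :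
    profile z = 2 * (z ^ 8 / (1 - z)).re := by
  have : discCutoff z = 1 := discCutoff.one_of_mem_closedBall (by simpa [discCutoff] using hz)
  simp [profile, this]

lemma exists_bound_iteratedFDeriv_profile (m : ℕ) :
    ∃ C, ∀ z, ‖iteratedFDeriv ℝ m profile z‖ ≤ C :=
  (hasCompactSupport_profile.iteratedFDeriv m).exists_bound_of_continuous
    (contDiff_profile.continuous_iteratedFDeriv (m := m) (by exact_mod_cast le_top))

lemma laplacian_re_eq_zero {F : ℂ → ℂ} {z : ℂ} (hF : AnalyticAt ℂ F z) :
    Laplacian.laplacian (fun y => (F y).re) z = 0 :=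
  hF.harmonicAt_re.2.self_of_nhds

lemma laplacian_profile_eq_zero {z : ℂ} (hz : ‖z‖ < 1 / 2) :
    Laplacian.laplacian profile z = 0 := by
  have h0 : profile =ᶠ[𝓝 z] fun y => (2 * (y ^ 8 / (1 - y))).re := by
    filter_upwards [continuous_norm.continuousAt.eventually (gt_mem_nhds hz)] with y hy
    rw [profile_eq_of_norm_le hy.le]
    simp
  rw [(InnerProductSpace.laplacian_congr_nhds h0).self_of_nhds]
  apply laplacian_re_eq_zero
  have : 1 - z ≠ 0 := by
    intro h
    rw [← sub_eq_zero.1 h] at hz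
    norm_num at hz
  fun_prop (disch := assumption)

lemma pow_div_one_sub_sub_sum {z : ℂ} (hz : z ≠ 1) (m : ℕ) :
    z ^ 8 / (1 - z) - ∑ j ∈ Finset.Ico 8 m, z ^ j = z ^ max 8 m / (1 - z) := by
  have h : 1 - z ≠ 0 := sub_ne_zero.2 hz.symm
  rcases le_total m 8 with hm | hm
  · simp [Finset.Ico_eq_empty_of_le hm, max_eq_left hm]
  · rw [max_eq_right hm, geom_sum_Ico hz hm, ← neg_sub 1 z]
    field_simp
    ring

/-- The Taylor remainder of `profile` is bounded by a multiple of `‖z‖ ^ m`, globally on `ℂ`. -/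
lemma exists_bound_profile_sub_sum (m : ℕ) : ∃ C, ∀ z : ℂ,
    |profile z - 2 * ∑ j ∈ Finset.Ico 8 m, (z ^ j).re| ≤ C * ‖z‖ ^ m := by
  obtain ⟨B, hB⟩ := hasCompactSupport_profile.exists_bound_of_continuous
    contDiff_profile.continuous
  have hB0 : 0 ≤ B := (norm_nonneg _).trans (hB 0)
  refine ⟨4 + (B + 2 * m) * 2 ^ m, fun z => ?_⟩
  have hpos : 0 ≤ (B + 2 * m) * 2 ^ m := by positivity
  rcases le_total ‖z‖ (1 / 2) with hz | hz
  · have hz1 : z ≠ 1 := by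
      rintro rfl
      norm_num at hz
    have h1 : profile z - 2 * ∑ j ∈ Finset.Ico 8 m, (z ^ j).re =
        2 * (z ^ max 8 m / (1 - z)).re := by
      rw [profile_eq_of_norm_le hz, ← pow_div_one_sub_sub_sum hz1, Complex.sub_re,
        Complex.re_sum]
      ring
    have h2 : 1 / 2 ≤ ‖1 - z‖ := by
      have := norm_sub_norm_le (1 : ℂ) z
      rw [norm_one] at this
      linarith
    have h3 : |(z ^ max 8 m / (1 - z)).re| ≤ 2 * ‖z‖ ^ m := by
      refine (Complex.abs_re_le_norm _).trans ?_
      rw [norm_div, norm_pow, div_le_iff₀ (by linarith)]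
      have h4 : ‖z‖ ^ max 8 m ≤ ‖z‖ ^ m :=
        pow_le_pow_of_le_one (norm_nonneg z) (by linarith) (le_max_right _ _)
      have h5 : 0 ≤ ‖z‖ ^ m := by positivity
      nlinarith
    rw [h1, abs_mul, abs_two]
    have h5 : 0 ≤ ‖z‖ ^ m := by positivity
    nlinarith
  · have h1 : 1 ≤ 2 * ‖z‖ := by linarith
    have h2 : ∀ j ∈ Finset.Ico 8 m, |(z ^ j).re| ≤ (2 * ‖z‖) ^ m := by
      intro j hj
      refine (Complex.abs_re_le_norm _).trans ?_
      rw [norm_pow]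
      calc ‖z‖ ^ j ≤ (2 * ‖z‖) ^ j := by gcongr; linarith [norm_nonneg z]
        _ ≤ (2 * ‖z‖) ^ m := pow_le_pow_right₀ h1 (Finset.mem_Ico.1 hj).2.le
    have h3 : |∑ j ∈ Finset.Ico 8 m, (z ^ j).re| ≤ m * (2 * ‖z‖) ^ m := by
      refine (Finset.abs_sum_le_sum_abs _ _).trans ((Finset.sum_le_card_nsmul _ _ _ h2).trans ?_)
      rw [nsmul_eq_mul, Nat.card_Ico]
      gcongr
      omega
    have h4 : |profile z| ≤ B * (2 * ‖z‖) ^ m :=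
      (hB z).trans (le_mul_of_one_le_right hB0 (one_le_pow₀ h1))
    calc |profile z - 2 * ∑ j ∈ Finset.Ico 8 m, (z ^ j).re|
        ≤ |profile z| + |2 * ∑ j ∈ Finset.Ico 8 m, (z ^ j).re| := abs_sub _ _
      _ ≤ B * (2 * ‖z‖) ^ m + 2 * (m * (2 * ‖z‖) ^ m) := by
        rw [abs_mul, abs_two]; gcongr
      _ = (B + 2 * m) * 2 ^ m * ‖z‖ ^ m := by rw [mul_pow]; ring
      _ ≤ _ := by
        have h5 : 0 ≤ ‖z‖ ^ m := by positivity
        nlinarith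

/-! ### The divergent sequence of coefficients -/

/-- The dilation factors of the building blocks. -/
noncomputable def scale (k : ℕ) : ℝ := k + 2

/-- The weights of the building blocks. They decay fast enough to make the weighted sum of dilated
blocks smooth, and slowly enough for the moments `∑ k, weight k * scale k ^ j` to have radius of
convergence `0`. -/
noncomputable def weight (k : ℕ) : ℝ := Real.exp (-5 * scale k ^ 2)

/-- The Taylor coefficients: the moments of the weights. -/
noncomputable def coeff (j : ℕ) : ℝ := ∑' k, weight k * scale k ^ j

lemma two_le_scale (k : ℕ) : 2 ≤ scale k := by simp [scale]

lemma scale_pos (k : ℕ) : 0 < scale k := two_pos.trans_le (two_le_scale k)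

lemma weight_pos (k : ℕ) : 0 < weight k := Real.exp_pos _

lemma summable_exp_mul_scale_pow (m : ℕ) :
    Summable fun k => Real.exp (-scale k ^ 2) * scale k ^ m := by
  have h := (summable_nat_add_iff 2).2 (Real.summable_pow_mul_exp_neg_nat_mul m one_pos)
  refine h.of_nonneg_of_le (fun k => ?_) fun k => ?_
  · have := scale_pos k
    positivity
  · have h2 := two_le_scale k
    have h3 : ((k + 2 : ℕ) : ℝ) = scale k := by simp [scale]
    rw [h3, mul_comm]
    gcongr
    nlinarith

lemma weight_eq (k : ℕ) :
    weight k = Real.exp (-scale k ^ 2) * Real.exp (-(4 * scale k ^ 2)) := by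
  rw [weight, ← Real.exp_add]
  ring_nf

lemma summable_weight_mul_scale_pow (m : ℕ) : Summable fun k => weight k * scale k ^ m := by
  refine (summable_exp_mul_scale_pow m).of_nonneg_of_le (fun k => ?_) fun k => ?_
  · have := scale_pos k
    have := weight_pos k
    positivity
  · have := scale_pos k
    rw [weight_eq]
    gcongr
    exact mul_le_of_le_one_right (Real.exp_pos _).le (Real.exp_le_one_iff.2 (by nlinarith))

lemma weight_mul_scale_pow_le_coeff (j k : ℕ) : weight k * scale k ^ j ≤ coeff j :=
  (summable_weight_mul_scale_pow j).le_tsum k fun i _ =>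
    mul_nonneg (weight_pos i).le (pow_nonneg (scale_pos i).le _)

lemma coeff_pos (j : ℕ) : 0 < coeff j :=
  (mul_pos (weight_pos 0) (pow_pos (scale_pos 0) j)).trans_le (weight_mul_scale_pow_le_coeff j 0)

lemma strictMono_coeff : StrictMono coeff := by
  refine strictMono_nat_of_lt_succ fun j => ?_
  have h : ∀ k, weight k * scale k ^ j < weight k * scale k ^ (j + 1) := fun k =>
    mul_lt_mul_of_pos_left
      (pow_lt_pow_right₀ (one_lt_two.trans_le (two_le_scale k)) j.lt_succ_self) (weight_pos k)
  exact Summable.tsum_lt_tsum (i := 0) (fun k => (h k).le) (h 0)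
    (summable_weight_mul_scale_pow j) (summable_weight_mul_scale_pow (j + 1))

/-- Each single dilation factor `scale k` bounds the radius of convergence by `(scale k)⁻¹`. -/
lemma not_summable_coeff_mul_pow {z : ℂ} (hz : z ≠ 0) :
    ¬ Summable fun j : ℕ => (coeff j : ℂ) * z ^ j := by
  intro h
  obtain ⟨k, hk⟩ := exists_nat_gt ‖z‖⁻¹
  have hz' : 0 < ‖z‖ := norm_pos_iff.2 hz
  have h1 : 1 ≤ scale k * ‖z‖ := by
    have : ‖z‖⁻¹ ≤ scale k := by unfold scale; linarith
    calc (1 : ℝ) = ‖z‖⁻¹ * ‖z‖ := (inv_mul_cancel₀ hz'.ne').symm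
      _ ≤ _ := by gcongr
  have h2 := h.tendsto_atTop_zero.norm
  rw [norm_zero] at h2
  obtain ⟨j, hj⟩ := (h2.eventually (gt_mem_nhds (weight_pos k))).exists
  refine hj.not_ge ?_
  rw [norm_mul, norm_pow, Complex.norm_real, Real.norm_of_nonneg (coeff_pos j).le]
  calc weight k ≤ weight k * (scale k * ‖z‖) ^ j :=
        le_mul_of_one_le_right (weight_pos k).le (one_le_pow₀ h1)
    _ = weight k * scale k ^ j * ‖z‖ ^ j := by rw [mul_pow, mul_assoc]
    _ ≤ coeff j * ‖z‖ ^ j := by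
        gcongr
        exact weight_mul_scale_pow_le_coeff j k

/-! ### The subharmonic function with divergent Taylor series -/

/-- The `k`-th dilated and weighted building block. -/
noncomputable def dilatedProfile (k : ℕ) (z : ℂ) : ℝ := weight k * profile (scale k • z)

lemma contDiff_dilatedProfile (k : ℕ) : ContDiff ℝ ∞ (dilatedProfile k) :=
  contDiff_const.mul (contDiff_profile.comp (contDiff_const_smul (scale k)))

lemma iteratedFDeriv_dilatedProfile (k m : ℕ) (z : ℂ) :
    iteratedFDeriv ℝ m (dilatedProfile k) z =
      (weight k * scale k ^ m) • iteratedFDeriv ℝ m profile (scale k • z) := by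
  have hp : ContDiff ℝ m profile := contDiff_profile.of_le (by exact_mod_cast le_top)
  have h1 : dilatedProfile k = fun z => weight k • (fun y => profile (scale k • y)) z := by
    ext z; simp [dilatedProfile]
  have h2 : ContDiff ℝ m fun y => profile (scale k • y) := hp.comp (contDiff_const_smul (scale k))
  rw [h1, iteratedFDeriv_const_smul_apply' h2.contDiffAt,
    iteratedFDeriv_comp_const_smul _ hp, smul_smul]

/-- Bounds for the derivatives of the dilated blocks, uniform on the plane. -/
lemma exists_bound_iteratedFDeriv_dilatedProfile : ∃ v : ℕ → ℕ → ℝ,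
    (∀ m : ℕ, Summable (v m)) ∧
      ∀ (m k : ℕ) (z : ℂ), ‖iteratedFDeriv ℝ m (dilatedProfile k) z‖ ≤ v m k := by
  choose C hC using exists_bound_iteratedFDeriv_profile
  refine ⟨fun m k => weight k * scale k ^ m * C m,
    fun m => (summable_weight_mul_scale_pow m).mul_right _, fun m k z => ?_⟩
  have h := mul_pos (weight_pos k) (pow_pos (scale_pos k) m)
  rw [iteratedFDeriv_dilatedProfile, norm_smul, Real.norm_of_nonneg h.le]
  exact mul_le_mul_of_nonneg_left (hC m _) h.le

/-- The sum of all dilated and weighted building blocks. It has the required Taylor series, and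
its Laplacian is flat at the origin. -/
noncomputable def profileSum (z : ℂ) : ℝ := ∑' k, dilatedProfile k z

lemma contDiff_profileSum : ContDiff ℝ ∞ profileSum := by
  obtain ⟨v, hv, hb⟩ := exists_bound_iteratedFDeriv_dilatedProfile
  exact contDiff_tsum (N := ⊤) contDiff_dilatedProfile (fun m _ => hv m) fun m k z _ => hb m k z

lemma hasSum_laplacian_profileSum (z : ℂ) :
    HasSum (fun k => weight k * scale k ^ 2 * Laplacian.laplacian profile (scale k • z))
      (Laplacian.laplacian profileSum z) := by
  obtain ⟨v, hv, hb⟩ := exists_bound_iteratedFDeriv_dilatedProfile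
  have h1 : HasSum (fun k => iteratedFDeriv ℝ 2 (dilatedProfile k) z)
      (iteratedFDeriv ℝ 2 profileSum z) := by
    have := iteratedFDeriv_tsum_apply (N := ⊤) contDiff_dilatedProfile (fun m _ => hv m)
      (fun m k z _ => hb m k z) (k := 2) le_top z
    unfold profileSum
    rw [this]
    exact (Summable.of_norm_bounded (hv 2) fun k => hb 2 k z).hasSum
  have h2 : ∀ u : Fin 2 → ℂ, HasSum (fun k => iteratedFDeriv ℝ 2 (dilatedProfile k) z u)
      (iteratedFDeriv ℝ 2 profileSum z u) := fun u =>
    h1.mapL (ContinuousMultilinearMap.apply ℝ (fun _ : Fin 2 => ℂ) ℝ u)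
  simp_rw [InnerProductSpace.laplacian_eq_iteratedFDeriv_complexPlane]
  convert (h2 ![1, 1]).add (h2 ![Complex.I, Complex.I]) using 2 with k
  simp only [iteratedFDeriv_dilatedProfile]
  simp
  ring

lemma exists_bound_laplacian_profile : ∃ C, 0 ≤ C ∧ ∀ z, |Laplacian.laplacian profile z| ≤ C := by
  obtain ⟨C, hC⟩ := exists_bound_iteratedFDeriv_profile 2
  have hC0 : 0 ≤ C := (norm_nonneg _).trans (hC 0)
  refine ⟨C + C, by positivity, fun z => ?_⟩
  rw [InnerProductSpace.laplacian_eq_iteratedFDeriv_complexPlane]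
  have h : ∀ v : ℂ, ‖v‖ = 1 → |iteratedFDeriv ℝ 2 profile z ![v, v]| ≤ C := by
    intro v hv
    refine ((iteratedFDeriv ℝ 2 profile z).le_opNorm ![v, v]).trans ?_
    simpa [Fin.prod_univ_two, hv] using hC z
  exact (abs_add_le _ _).trans (add_le_add (h 1 (by simp)) (h Complex.I (by simp)))

/-- The Laplacian of the `k`-th block vanishes for `scale k * ‖z‖ < 1 / 2`; for the other `z`, the
weight `exp (-5 * scale k ^ 2)` is dominated by `exp (-1 / ‖z‖ ^ 2)`. -/
lemma exists_bound_laplacian_profileSum : ∃ K, 0 ≤ K ∧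
    ∀ z, |Laplacian.laplacian profileSum z| ≤ K * expNegInvGlue (‖z‖ ^ 2) := by
  obtain ⟨C, hC0, hC⟩ := exists_bound_laplacian_profile
  have hs := summable_exp_mul_scale_pow 2
  refine ⟨(∑' k, Real.exp (-scale k ^ 2) * scale k ^ 2) * C, mul_nonneg (tsum_nonneg fun k =>
    mul_nonneg (Real.exp_pos _).le (sq_nonneg _)) hC0, fun z => ?_⟩
  have hg := expNegInvGlue.nonneg (‖z‖ ^ 2)
  have hterm : ∀ k, ‖weight k * scale k ^ 2 * Laplacian.laplacian profile (scale k • z)‖ ≤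
      Real.exp (-scale k ^ 2) * scale k ^ 2 * C * expNegInvGlue (‖z‖ ^ 2) := by
    intro k
    have hk := scale_pos k
    have hnorm : ‖scale k • z‖ = scale k * ‖z‖ := by
      rw [norm_smul, Real.norm_of_nonneg hk.le]
    by_cases h : scale k * ‖z‖ < 1 / 2
    · rw [laplacian_profile_eq_zero (by rwa [hnorm])]
      simp only [mul_zero, norm_zero]
      positivity
    · -- Here `1 / ‖z‖ ^ 2 ≤ 4 * scale k ^ 2`.
      push Not at h
      have hz : 0 < ‖z‖ := by
        by_contra hz
        rw [le_antisymm (not_lt.1 hz) (norm_nonneg z)] at h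
        norm_num at h
      have h1 : Real.exp (-(4 * scale k ^ 2)) ≤ expNegInvGlue (‖z‖ ^ 2) := by
        rw [expNegInvGlue, if_neg (sq_pos_of_pos hz).not_ge]
        refine Real.exp_le_exp.2 (neg_le_neg ?_)
        rw [inv_le_iff_one_le_mul₀ (by positivity)]
        nlinarith
      rw [norm_mul, Real.norm_eq_abs (Laplacian.laplacian profile _), Real.norm_of_nonneg
        (mul_nonneg (weight_pos k).le (sq_nonneg _)), weight_eq]
      calc Real.exp (-scale k ^ 2) * Real.exp (-(4 * scale k ^ 2)) * scale k ^ 2 *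
            |Laplacian.laplacian profile (scale k • z)|
          ≤ Real.exp (-scale k ^ 2) * expNegInvGlue (‖z‖ ^ 2) * scale k ^ 2 * C := by
            gcongr
            exact hC _
        _ = _ := by ring
  have := tsum_of_norm_bounded ((hs.hasSum.mul_right C).mul_right (expNegInvGlue (‖z‖ ^ 2))) hterm
  rwa [(hasSum_laplacian_profileSum z).tsum_eq] at this

lemma summable_dilatedProfile (z : ℂ) : Summable fun k => dilatedProfile k z := by
  obtain ⟨v, hv, hb⟩ := exists_bound_iteratedFDeriv_dilatedProfile
  exact Summable.of_norm_bounded (hv 0) fun k => by simpa using hb 0 k z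

lemma profileSum_sub_sum_isBigO (m : ℕ) :
    (fun z : ℂ => profileSum z - 2 * ∑ j ∈ Finset.Ico 8 m, ((coeff j : ℂ) * z ^ j).re)
      =O[𝓝 0] fun z => ‖z‖ ^ m := by
  obtain ⟨C, hC⟩ := exists_bound_profile_sub_sum m
  refine IsBigO.of_bound (coeff m * C) (Eventually.of_forall fun z => ?_)
  have h1 : HasSum (fun k => weight k * (profile (scale k • z) -
      2 * ∑ j ∈ Finset.Ico 8 m, ((scale k • z) ^ j).re))
      (profileSum z - 2 * ∑ j ∈ Finset.Ico 8 m, ((coeff j : ℂ) * z ^ j).re) := by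
    have h2 : HasSum (fun k => ∑ j ∈ Finset.Ico 8 m, weight k * scale k ^ j * (z ^ j).re)
        (∑ j ∈ Finset.Ico 8 m, coeff j * (z ^ j).re) :=
      hasSum_sum fun j _ => (summable_weight_mul_scale_pow j).hasSum.mul_right _
    have h5 : profileSum z - 2 * ∑ j ∈ Finset.Ico 8 m, ((coeff j : ℂ) * z ^ j).re =
        profileSum z - 2 * ∑ j ∈ Finset.Ico 8 m, coeff j * (z ^ j).re := by simp
    have h6 : (fun k => weight k * (profile (scale k • z) -
        2 * ∑ j ∈ Finset.Ico 8 m, ((scale k • z) ^ j).re)) = fun k =>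
        dilatedProfile k z - 2 * ∑ j ∈ Finset.Ico 8 m, weight k * scale k ^ j * (z ^ j).re := by
      ext k
      simp only [dilatedProfile]
      rw [mul_sub, Finset.mul_sum, Finset.mul_sum, Finset.mul_sum]
      congr 1
      refine Finset.sum_congr rfl fun j _ => ?_
      rw [smul_pow, Complex.smul_re, smul_eq_mul]
      ring
    rw [h5, h6]
    exact (summable_dilatedProfile z).hasSum.sub (h2.mul_left 2)
  have h3 : ∀ k, ‖weight k * (profile (scale k • z) -
      2 * ∑ j ∈ Finset.Ico 8 m, ((scale k • z) ^ j).re)‖ ≤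
      weight k * scale k ^ m * (C * ‖z‖ ^ m) := by
    intro k
    rw [norm_mul, Real.norm_of_nonneg (weight_pos k).le, mul_assoc]
    refine mul_le_mul_of_nonneg_left ((hC _).trans_eq ?_) (weight_pos k).le
    rw [norm_smul, Real.norm_of_nonneg (scale_pos k).le, mul_pow]
    ring
  have h4 := tsum_of_norm_bounded ((summable_weight_mul_scale_pow m).hasSum.mul_right _) h3
  rw [h1.tsum_eq] at h4
  refine h4.trans_eq ?_
  rw [norm_pow, norm_norm, coeff]
  ring

/-- The flat correction `K * flatRadial` makes the sum of the building blocks subharmonic without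
changing its Taylor series. -/
theorem exists_subharmonic_hasTaylorSeriesRe :
    ∃ f : ℂ → ℝ, IsSmoothSubharmonic f ∧ HasTaylorSeriesRe f coeff := by
  obtain ⟨K, hK0, hK⟩ := exists_bound_laplacian_profileSum
  have two_le : (2 : WithTop ℕ∞) ≤ ((⊤ : ℕ∞) : WithTop ℕ∞) := WithTop.coe_le_coe.2 le_top
  have hflat : ContDiff ℝ ∞ (K • flatRadial) := contDiff_flatRadial.const_smul K
  refine ⟨profileSum + K • flatRadial, ⟨contDiff_profileSum.add hflat, fun z => ?_⟩, fun m => ?_⟩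
  · rw [ContDiffAt.laplacian_add (contDiff_profileSum.of_le two_le).contDiffAt
      (hflat.of_le two_le).contDiffAt,
      InnerProductSpace.laplacian_smul _
        (contDiff_flatRadial.of_le two_le).contDiffAt, smul_eq_mul]
    have h1 := (abs_le.1 (hK z)).1
    have h2 := mul_le_mul_of_nonneg_left (le_laplacian_flatRadial z) hK0
    have h3 := mul_nonneg hK0 (expNegInvGlue.nonneg (‖z‖ ^ 2))
    linarith
  · refine ((profileSum_sub_sum_isBigO m).add
      ((flatRadial_isBigO m).const_mul_left K)).congr_left fun z => ?_
    simp only [Pi.add_apply, Pi.smul_apply, smul_eq_mul]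
    ring

/-! ### Stability properties of smooth subharmonic functions -/

lemma IsSmoothSubharmonic.add {f g : ℂ → ℝ} (hf : IsSmoothSubharmonic f)
    (hg : IsSmoothSubharmonic g) : IsSmoothSubharmonic (fun z => f z + g z) := by
  have two_le : (2 : WithTop ℕ∞) ≤ ((⊤ : ℕ∞) : WithTop ℕ∞) := WithTop.coe_le_coe.2 le_top
  refine ⟨hf.1.add hg.1, fun z => ?_⟩
  have := ContDiffAt.laplacian_add (hf.1.of_le two_le).contDiffAt (hg.1.of_le two_le).contDiffAt
    (x := z)
  exact (add_nonneg (hf.2 z) (hg.2 z)).trans_eq this.symm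

lemma isSmoothSubharmonic_const (c : ℝ) : IsSmoothSubharmonic fun _ => c :=
  ⟨contDiff_const, fun z => by simp⟩

lemma isSmoothSubharmonic_sum {ι : Type*} (s : Finset ι) {f : ι → ℂ → ℝ}
    (hf : ∀ i ∈ s, IsSmoothSubharmonic (f i)) :
    IsSmoothSubharmonic (fun z => ∑ i ∈ s, f i z) := by
  classical
  induction s using Finset.induction_on with
  | empty => simpa using isSmoothSubharmonic_const 0
  | insert a s ha ih =>
    simp only [Finset.sum_insert ha]
    exact (hf a (Finset.mem_insert_self a s)).add
      (ih fun i hi => hf i (Finset.mem_insert_of_mem hi))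

lemma contDiff_real_of_differentiable {F : ℂ → ℂ} (hF : Differentiable ℂ F) : ContDiff ℝ ∞ F :=
  ContDiff.restrict_scalars ℝ (𝕜' := ℂ) hF.contDiff

lemma isSmoothSubharmonic_re {F : ℂ → ℂ} (hF : Differentiable ℂ F) :
    IsSmoothSubharmonic fun z => (F z).re :=
  ⟨Complex.reCLM.contDiff.comp (contDiff_real_of_differentiable hF), fun z =>
    (laplacian_re_eq_zero (hF.analyticAt z)).ge⟩

lemma isSmoothSubharmonic_norm_sq {F : ℂ → ℂ} (hF : Differentiable ℂ F) :
    IsSmoothSubharmonic fun z => ‖F z‖ ^ 2 := by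
  have h1 : ∀ G : ℂ → ℂ, Differentiable ℂ G → IsSmoothSubharmonic fun z => (G z).re ^ 2 :=
    fun G hG => ⟨(isSmoothSubharmonic_re hG).1.pow 2, fun z => laplacian_sq_nonneg
      (isSmoothSubharmonic_re hG).1 (laplacian_re_eq_zero (hG.analyticAt z))⟩
  -- `|F| ^ 2 = (Re F) ^ 2 + (Re (-i F)) ^ 2`
  have h2 := (h1 F hF).add (h1 (fun z => -Complex.I * F z) (hF.const_mul _))
  convert h2 using 2 with z
  rw [← Complex.normSq_eq_norm_sq, Complex.normSq_apply]
  simp [sq]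

lemma fderiv_comp_line {E : Type*} [NormedAddCommGroup E] [NormedSpace ℝ E] [NormedSpace ℂ E]
    [IsScalarTower ℝ ℂ E] {r : E → ℝ} (hr : ContDiff ℝ ∞ r) (z v : E) (t : ℂ) (a b : ℂ) :
    fderiv ℝ (fderiv ℝ fun s : ℂ => r (z + s • v)) t a b =
      fderiv ℝ (fderiv ℝ r) (z + t • v) (a • v) (b • v) := by
  set L : ℂ →L[ℝ] E := (ContinuousLinearMap.toSpanSingleton ℂ v).restrictScalars ℝ with hL
  have hline : ∀ s : ℂ, HasFDerivAt (fun s : ℂ => z + s • v) L s := fun s =>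
    (L.hasFDerivAt.const_add z)
  have hd : Differentiable ℝ r := hr.differentiable (by simp)
  have hd' : Differentiable ℝ (fderiv ℝ r) :=
    (hr.fderiv_right (m := ∞) (by simp)).differentiable (by simp)
  have h1 : (fderiv ℝ fun s : ℂ => r (z + s • v)) =
      fun s => (fderiv ℝ r (z + s • v)).comp L := by
    ext1 s
    exact ((hd _).hasFDerivAt.comp s (hline s)).fderiv
  have h2 := (((hd' (z + t • v)).hasFDerivAt.comp t (hline t)).clm_comp
    (hasFDerivAt_const L t)).fderiv
  rw [h1]
  simp only [Function.comp_def] at h2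
  rw [h2]
  simp [hL]

lemma laplacian_comp_line {E : Type*} [NormedAddCommGroup E] [NormedSpace ℝ E] [NormedSpace ℂ E]
    [IsScalarTower ℝ ℂ E] {r : E → ℝ} (hr : ContDiff ℝ ∞ r) (z v : E) (t : ℂ) :
    Laplacian.laplacian (fun s : ℂ => r (z + s • v)) t =
      fderiv ℝ (fderiv ℝ r) (z + t • v) v v +
        fderiv ℝ (fderiv ℝ r) (z + t • v) (Complex.I • v) (Complex.I • v) := by
  rw [laplacian_eq_fderiv_fderiv, fderiv_comp_line hr, fderiv_comp_line hr]
  simp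

lemma IsSmoothSubharmonic.comp_affine {f : ℂ → ℝ} (hf : IsSmoothSubharmonic f) (a b : ℂ) :
    IsSmoothSubharmonic fun t => f (a + t * b) := by
  refine ⟨hf.1.comp (contDiff_const.add (contDiff_id.mul contDiff_const)), fun t => ?_⟩
  have h := laplacian_comp_line hf.1 a b t
  simp only [smul_eq_mul] at h
  rw [h, bilin_mul_add_bilin_mul_I, ← laplacian_eq_fderiv_fderiv]
  exact mul_nonneg (sq_nonneg _) (hf.2 _)

/-! ### The Levi form as a Laplacian along complex lines -/

lemma wirtinger_wirtingerBar {N : ℕ} {r : (Fin N → ℂ) → ℝ} (hr : ContDiff ℝ ∞ r) (j k : Fin N)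
    (z : Fin N → ℂ) :
    wirtinger j (wirtingerBar k fun x => (r x : ℂ)) z =
      (1 / 4) * (fderiv ℝ (fderiv ℝ r) z (Pi.single j 1) (Pi.single k 1) +
        Complex.I * fderiv ℝ (fderiv ℝ r) z (Pi.single j 1) (Pi.single k Complex.I) -
        Complex.I * (fderiv ℝ (fderiv ℝ r) z (Pi.single j Complex.I) (Pi.single k 1) +
          Complex.I * fderiv ℝ (fderiv ℝ r) z (Pi.single j Complex.I)
            (Pi.single k Complex.I))) := by
  have hd : Differentiable ℝ r := hr.differentiable (by simp)
  have hd' : Differentiable ℝ (fderiv ℝ r) :=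
    (hr.fderiv_right (m := ∞) (by simp)).differentiable (by simp)
  have h1 : ∀ x u, fderiv ℝ (fun x => (r x : ℂ)) x u = (fderiv ℝ r x u : ℂ) := by
    intro x u
    have := (Complex.ofRealCLM.hasFDerivAt.comp x (hd x).hasFDerivAt).fderiv
    simp only [Function.comp_def, Complex.ofRealCLM_apply] at this
    rw [this]
    simp
  have h2 : ∀ u, HasFDerivAt (fun x => (fderiv ℝ r x u : ℂ))
      (Complex.ofRealCLM.comp ((fderiv ℝ (fderiv ℝ r) z).flip u)) z := fun u =>
    Complex.ofRealCLM.hasFDerivAt.comp z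
      (((ContinuousLinearMap.apply ℝ ℝ u).hasFDerivAt.comp z (hd' z).hasFDerivAt))
  have h3 : wirtingerBar k (fun x => (r x : ℂ)) = fun x => (1 / 2 : ℂ) *
      ((fderiv ℝ r x (Pi.single k 1) : ℂ) +
        Complex.I * (fderiv ℝ r x (Pi.single k Complex.I) : ℂ)) := by
    ext x
    simp only [wirtingerBar, h1]
  have h4 := (((h2 (Pi.single k 1)).add
    ((h2 (Pi.single k Complex.I)).const_mul Complex.I)).const_mul (1 / 2 : ℂ)).fderiv
  rw [h3, wirtinger]
  simp only [Pi.add_apply] at h4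
  erw [h4]
  simp
  ring

/-- The Levi form is a quarter of the Laplacian along the complex line in the given direction. Both
sides are traces of the real Hessian, and they agree term by term in coordinates. -/
lemma leviForm_eq_laplacian {N : ℕ} {r : (Fin N → ℂ) → ℝ} (hr : ContDiff ℝ ∞ r)
    (z v : Fin N → ℂ) :
    leviForm r z v = (1 / 4) * Laplacian.laplacian (fun t : ℂ => r (z + t • v)) 0 := by
  set B := fderiv ℝ (fderiv ℝ r) z with hB
  have hv : v = ∑ j, ((v j).re • (Pi.single j 1 : Fin N → ℂ) +
      (v j).im • (Pi.single j Complex.I : Fin N → ℂ)) := by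
    ext i
    simp [Finset.sum_apply, Pi.single_apply, Finset.sum_add_distrib]
  have hIv : Complex.I • v =
      ∑ j, ((-(v j).im) • (Pi.single j 1 : Fin N → ℂ) +
        (v j).re • (Pi.single j Complex.I : Fin N → ℂ)) := by
    ext i
    apply Complex.ext <;>
      simp [Finset.sum_apply, Pi.single_apply, Finset.sum_add_distrib]
  have hexp : ∀ a b : Fin N → ℝ,
      B (∑ j, (a j • (Pi.single j 1 : Fin N → ℂ) + b j • (Pi.single j Complex.I : Fin N → ℂ)))
        (∑ j, (a j • (Pi.single j 1 : Fin N → ℂ) + b j • (Pi.single j Complex.I : Fin N → ℂ))) =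
      ∑ j, ∑ k, (a j * a k * B (Pi.single j 1) (Pi.single k 1) +
        a j * b k * B (Pi.single j 1) (Pi.single k Complex.I) +
        b j * a k * B (Pi.single j Complex.I) (Pi.single k 1) +
        b j * b k * B (Pi.single j Complex.I) (Pi.single k Complex.I)) := by
    intro a b
    simp only [map_sum, map_add, map_smul, sum_apply, add_apply, smul_apply, smul_eq_mul]
    rw [Finset.sum_comm]
    refine Finset.sum_congr rfl fun j _ => ?_
    rw [Finset.mul_sum, Finset.mul_sum, ← Finset.sum_add_distrib]
    refine Finset.sum_congr rfl fun k _ => ?_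
    ring
  rw [laplacian_comp_line hr, zero_smul, add_zero, ← hB, hIv]
  nth_rewrite 2 3 [hv]
  rw [hexp, hexp, leviForm, ← Finset.sum_add_distrib, Finset.mul_sum, Complex.re_sum]
  refine Finset.sum_congr rfl fun j _ => ?_
  rw [← Finset.sum_add_distrib, Finset.mul_sum, Complex.re_sum]
  refine Finset.sum_congr rfl fun k _ => ?_
  rw [wirtinger_wirtingerBar hr]
  simp [← hB]
  ring

/-! ### Comparison of defining functions -/

/-- If `r` grows with constant speed in the direction `e`, then `r` is dominated near `0` by every
function `r'` which vanishes on the zero set of `r` and has nonvanishing differential at `0`: moving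
a point `x` by `r x / 2` in the direction `-e` leads to the zero set. -/
lemma isBigO_of_vanish_on_zeroSet {E : Type*} [NormedAddCommGroup E] [NormedSpace ℝ E]
    {r r' : E → ℝ} {e : E} (hr : DifferentiableAt ℝ r 0) (hr0 : r 0 = 0)
    (he : ∀ (x : E) (s : ℝ), r (x + s • e) = r x + 2 * s)
    (hr' : ContDiffAt ℝ 1 r' 0) (hzero : ∀ᶠ x in 𝓝 0, r x = 0 → r' x = 0)
    (hne : fderiv ℝ r' 0 ≠ 0) : r =O[𝓝 0] r' := by
  set π : E → E := fun x => x + (-(r x / 2)) • e with hπ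
  have hπr : ∀ x, r (π x) = 0 := fun x => by rw [hπ, he]; ring
  have hπ0 : π 0 = 0 := by simp [hπ, hr0]
  have hπd : HasFDerivAt π (ContinuousLinearMap.id ℝ E +
      ((-(1 / 2 : ℝ)) • fderiv ℝ r 0).smulRight e) 0 := by
    have h1 : HasFDerivAt (fun x => -(r x / 2)) ((-(1 / 2 : ℝ)) • fderiv ℝ r 0) 0 := by
      have h : (fun x => -(r x / 2)) = fun x => -(1 / 2 : ℝ) * r x := by ext x; ring
      rw [h]
      exact hr.hasFDerivAt.const_mul (-(1 / 2 : ℝ))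
    exact (hasFDerivAt_id (0 : E)).add (h1.smul_const e)
  have hπt : Tendsto π (𝓝 0) (𝓝 0) := by
    simpa [ContinuousAt, hπ0] using hπd.continuousAt
  have hr'π : ∀ᶠ x in 𝓝 0, r' (π x) = 0 :=
    (hπt.eventually hzero).mono fun x hx => hx (hπr x)
  -- `r' ∘ π` vanishes near `0`, so the differential of `r'` is a multiple of that of `r`.
  have hstrict : HasStrictFDerivAt r' (fderiv ℝ r' 0) 0 := hr'.hasStrictFDerivAt (by simp)
  have hD : ∀ u, fderiv ℝ r' 0 u = fderiv ℝ r 0 u / 2 * fderiv ℝ r' 0 e := by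
    intro u
    have h2 : HasFDerivAt r' (fderiv ℝ r' 0) (π 0) := by rw [hπ0]; exact hstrict.hasFDerivAt
    have h3 := h2.comp 0 hπd
    have h4 : (r' ∘ π) =ᶠ[𝓝 0] fun _ => (0 : ℝ) := hr'π
    have h5 := h3.unique ((hasFDerivAt_const (0 : ℝ) (0 : E)).congr_of_eventuallyEq h4)
    have h6 := DFunLike.congr_fun h5 u
    simp at h6
    linarith
  have hDe : fderiv ℝ r' 0 e ≠ 0 := by
    intro h
    refine hne (ContinuousLinearMap.ext fun u => ?_)
    rw [hD, h]
    simp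
  -- Strict differentiability along the segments from `π x` to `x`, where `r' (π x) = 0`.
  have hpair : Tendsto (fun x => (π x, x)) (𝓝 0) (𝓝 ((0, 0) : E × E)) :=
    hπt.prodMk_nhds tendsto_id
  have hlo : (fun x => (r x / 2) * fderiv ℝ r' 0 e - r' x) =o[𝓝 0]
      fun x => (r x / 2) * fderiv ℝ r' 0 e := by
    have h1 := (hasStrictFDerivAt_iff_isLittleO.1 hstrict).comp_tendsto hpair
    have h2 : (fun x => π x - x) =O[𝓝 0] fun x => (r x / 2) * fderiv ℝ r' 0 e := by
      refine IsBigO.of_bound (‖e‖ / ‖fderiv ℝ r' 0 e‖) (Eventually.of_forall fun x => ?_)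
      have : ‖fderiv ℝ r' 0 e‖ ≠ 0 := norm_ne_zero_iff.2 hDe
      rw [hπ, add_sub_cancel_left, norm_smul, norm_neg, norm_mul]
      field_simp
      rfl
    refine (h1.trans_isBigO h2).congr' (hr'π.mono fun x hx => ?_) EventuallyEq.rfl
    simp only [Function.comp_apply, hx, zero_sub]
    rw [hπ, add_sub_cancel_left, map_smul, smul_eq_mul]
    ring
  have h3 := hlo.right_isBigO_sub
  simp only [sub_sub_cancel] at h3
  refine IsBigO.trans
    (IsBigO.of_bound (2 / ‖fderiv ℝ r' 0 e‖) (Eventually.of_forall fun x => ?_)) h3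
  have : ‖fderiv ℝ r' 0 e‖ ≠ 0 := norm_ne_zero_iff.2 hDe
  rw [norm_mul, norm_div]
  field_simp
  simp

/-! ### The hypersurface -/

section

variable {n : ℕ} {f : ℂ → ℝ}

lemma exampleFunction_add_smul_single (hn : 2 ≤ n) (x : Fin (n + 1) → ℂ) (s : ℝ) :
    exampleFunction n f (x + s • (Pi.single (Fin.last n) 1 : Fin (n + 1) → ℂ)) =
      exampleFunction n f x + 2 * s := by
  have h0 : (0 : Fin (n + 1)) ≠ Fin.last n := by
    simp only [ne_eq, Fin.ext_iff, Fin.val_zero, Fin.val_last]; omega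
  have h1 : (1 : Fin (n + 1)) ≠ Fin.last n := by
    simp only [ne_eq, Fin.ext_iff, Fin.val_one', Fin.val_last]
    rw [Nat.mod_eq_of_lt (by omega)]; omega
  have h2 : ∀ j : Fin (n + 1), (if 2 ≤ j.val ∧ j.val < n then
      ‖(x + s • (Pi.single (Fin.last n) 1 : Fin (n + 1) → ℂ)) j‖ ^ 2 else 0) =
      if 2 ≤ j.val ∧ j.val < n then ‖x j‖ ^ 2 else 0 := by
    intro j
    split_ifs with hj
    · have : j ≠ Fin.last n := by
        simp only [ne_eq, Fin.ext_iff, Fin.val_last]; omega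
      simp [this]
    · rfl
  unfold exampleFunction
  simp only [h2]
  simp [h0, h1]
  ring

lemma contDiff_exampleFunction (hf : ContDiff ℝ ∞ f) : ContDiff ℝ ∞ (exampleFunction n f) := by
  have hp : ∀ j : Fin (n + 1), ContDiff ℝ ∞ fun x : Fin (n + 1) → ℂ => x j := fun j =>
    contDiff_apply ℝ ℂ j
  unfold exampleFunction
  refine (((contDiff_const.mul (Complex.reCLM.contDiff.comp (hp _))).add
    ((((hp 0).pow 3).sub ((hp 1).pow 2)).norm_sq ℝ)).add (hf.comp (hp 0))).add
    (ContDiff.sum fun j _ => ?_)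
  split_ifs
  · exact (hp j).norm_sq ℝ
  · exact contDiff_const

lemma fderiv_exampleFunction_ne_zero (hn : 2 ≤ n) (hf : ContDiff ℝ ∞ f) (x : Fin (n + 1) → ℂ) :
    fderiv ℝ (exampleFunction n f) x ≠ 0 := by
  intro h
  have hd := ((contDiff_exampleFunction (n := n) hf).differentiable (by simp) x).hasFDerivAt
  rw [h] at hd
  have h1 : HasDerivAt (fun s : ℝ => x + s • (Pi.single (Fin.last n) 1 : Fin (n + 1) → ℂ))
      (Pi.single (Fin.last n) 1) 0 := by
    simpa using ((hasDerivAt_id (0 : ℝ)).smul_const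
      (Pi.single (Fin.last n) 1 : Fin (n + 1) → ℂ)).const_add x
  have h2 := HasFDerivAt.comp_hasDerivAt (0 : ℝ) (by simpa using hd) h1
  have h3 : HasDerivAt (fun s : ℝ => exampleFunction n f x + 2 * s) 2 0 := by
    simpa using ((hasDerivAt_id (0 : ℝ)).const_mul 2).const_add (exampleFunction n f x)
  have h4 : (exampleFunction n f ∘ fun s : ℝ =>
      x + s • (Pi.single (Fin.last n) 1 : Fin (n + 1) → ℂ)) =
      fun s : ℝ => exampleFunction n f x + 2 * s :=
    funext fun s => exampleFunction_add_smul_single hn x s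
  rw [h4] at h2
  simpa using h2.unique h3

lemma isDefiningFunction_exampleFunction (hn : 2 ≤ n) (hf : ContDiff ℝ ∞ f) :
    IsDefiningFunction {x | exampleFunction n f x = 0} Set.univ (exampleFunction n f) :=
  ⟨isOpen_univ, (contDiff_exampleFunction hf).contDiffOn, fun _ _ => Iff.rfl,
    fun z _ => fderiv_exampleFunction_ne_zero hn hf z⟩

lemma isSmoothSubharmonic_exampleFunction_line (hf : IsSmoothSubharmonic f)
    (z v : Fin (n + 1) → ℂ) :
    IsSmoothSubharmonic fun t : ℂ => exampleFunction n f (z + t • v) := by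
  have hp : ∀ j : Fin (n + 1), Differentiable ℂ fun t : ℂ => z j + t * v j := fun j => by fun_prop
  have h1 : IsSmoothSubharmonic fun t : ℂ => 2 * (z (Fin.last n) + t * v (Fin.last n)).re := by
    convert isSmoothSubharmonic_re ((hp (Fin.last n)).const_mul 2) using 2 with t
    simp
  have h2 := isSmoothSubharmonic_norm_sq (((hp 0).pow 3).sub ((hp 1).pow 2))
  refine ((h1.add h2).add (hf.comp_affine (z 0) (v 0))).add
    (isSmoothSubharmonic_sum _ fun j _ => ?_)
  split_ifs
  · exact isSmoothSubharmonic_norm_sq (hp j)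
  · exact isSmoothSubharmonic_const 0

lemma isPseudoconvexHypersurface_exampleFunction (hn : 2 ≤ n) (hf : IsSmoothSubharmonic f) :
    IsPseudoconvexHypersurface {x | exampleFunction n f x = 0} := by
  refine ⟨Set.univ, exampleFunction n f, Set.subset_univ _,
    isDefiningFunction_exampleFunction hn hf.1, fun z _ v _ => ?_⟩
  rw [leviForm_eq_laplacian (contDiff_exampleFunction hf.1)]
  have := (isSmoothSubharmonic_exampleFunction_line hf z v).2 0
  positivity

lemma exampleFunction_zero (hf0 : f 0 = 0) : exampleFunction n f 0 = 0 := by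
  simp [exampleFunction, hf0]

/-- Vanishing of `r' ∘ φ` to some order for any local defining function `r'` thus implies the same
for `exampleFunction n f ∘ φ`. -/
lemma exampleFunction_isBigO_of_isLocalDefiningFunction (hn : 2 ≤ n) (hf : ContDiff ℝ ∞ f)
    (hf0 : f 0 = 0) {r' : (Fin (n + 1) → ℂ) → ℝ}
    (hr' : IsLocalDefiningFunction {x | exampleFunction n f x = 0} 0 r') :
    exampleFunction n f =O[𝓝 0] r' := by
  obtain ⟨U, h0U, hU, hsmooth, hzero, hne⟩ := hr'
  refine isBigO_of_vanish_on_zeroSet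
    ((contDiff_exampleFunction (n := n) hf).differentiable (by simp) 0)
    (exampleFunction_zero hf0) (exampleFunction_add_smul_single hn)
    ((hsmooth.contDiffAt (hU.mem_nhds h0U)).of_le (by simp)) ?_
    (hne 0 ⟨exampleFunction_zero hf0, h0U⟩)
  filter_upwards [hU.mem_nhds h0U] with x hx h
  exact (hzero x hx).1 h

end

/-! ### Orders of vanishing of holomorphic germs -/

lemma le_of_pow_isBigO_pow {m k : ℕ}
    (h : (fun s : ℝ => s ^ k) =O[𝓝[>] 0] fun s => s ^ m) : m ≤ k := by
  by_contra! hlt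
  have h1 : (fun s : ℝ => s ^ m) =o[𝓝[>] 0] fun s => s ^ k :=
    (isLittleO_pow_pow hlt).mono nhdsWithin_le_nhds
  have h2 := h.trans_isLittleO h1
  have h3 : ∃ᶠ s : ℝ in 𝓝[>] 0, s ^ k ≠ 0 := by
    refine Eventually.frequently ?_
    filter_upwards [self_mem_nhdsWithin] with s hs using pow_ne_zero _ (ne_of_gt hs)
  exact isLittleO_irrefl' (h3.mono fun s hs => norm_ne_zero_iff.2 hs) h2

lemma tendsto_smul_nhdsGT (u : ℂ) : Tendsto (fun s : ℝ => s • u) (𝓝[>] 0) (𝓝 0) := by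
  have : Continuous fun s : ℝ => s • u := by fun_prop
  simpa using (this.tendsto 0).mono_left nhdsWithin_le_nhds

/-- The order of a holomorphic germ can be read off along a single ray. -/
lemma le_mul_analyticOrderAt_of_isBigO_ray {g : ℂ → ℂ} (hg : AnalyticAt ℂ g 0) {u : ℂ}
    (hu : u ≠ 0) {p m : ℕ} (hp : p ≠ 0)
    (h : (fun s : ℝ => ‖g (s • u)‖ ^ p) =O[𝓝[>] 0] fun s => s ^ m) :
    (m : ℕ∞) ≤ p * analyticOrderAt g 0 := by
  by_cases htop : analyticOrderAt g 0 = ⊤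
  · rw [htop, ENat.mul_top (by exact_mod_cast hp)]
    exact le_top
  obtain ⟨k, hk⟩ := ENat.ne_top_iff_exists.1 htop
  obtain ⟨q, hq, hq0, hgq⟩ := (hg.analyticOrderAt_eq_natCast).1 hk.symm
  rw [← hk]
  norm_cast
  apply le_of_pow_isBigO_pow
  refine IsBigO.trans ?_ h
  have hray := tendsto_smul_nhdsGT u
  have h1 : ∀ᶠ s : ℝ in 𝓝[>] 0, ‖q 0‖ / 2 ≤ ‖q (s • u)‖ := by
    have := (hq.continuousAt.norm.tendsto.comp hray).eventually
      (lt_mem_nhds (half_lt_self (norm_pos_iff.2 hq0)))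
    exact this.mono fun s hs => hs.le
  refine IsBigO.of_bound ((‖u‖ ^ k * (‖q 0‖ / 2)) ^ p)⁻¹ ?_
  filter_upwards [h1, hray.eventually hgq, self_mem_nhdsWithin] with s hs hgs hpos
  have hs0 : (0 : ℝ) < s := hpos
  have hu0 : 0 < ‖u‖ := norm_pos_iff.2 hu
  have hq00 : 0 < ‖q 0‖ := norm_pos_iff.2 hq0
  rw [← div_eq_inv_mul, le_div_iff₀ (by positivity), norm_pow, norm_pow, norm_norm, hgs,
    norm_smul, norm_pow, sub_zero, norm_smul, Real.norm_of_nonneg hs0.le, mul_comm p k, pow_mul,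
    ← mul_pow]
  refine pow_le_pow_left₀ (by positivity) ?_ p
  rw [mul_pow, mul_assoc]
  gcongr

lemma le_analyticOrderAt_of_isBigO {g : ℂ → ℂ} (hg : AnalyticAt ℂ g 0) {m : ℕ}
    (h : g =O[𝓝 0] fun t => ‖t‖ ^ m) : (m : ℕ∞) ≤ analyticOrderAt g 0 := by
  have h1 := h.norm_left.comp_tendsto (tendsto_smul_nhdsGT 1)
  have h2 := le_mul_analyticOrderAt_of_isBigO_ray hg one_ne_zero one_ne_zero (m := m)
    (h1.congr' (Eventually.of_forall fun s => by simp) (by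
      filter_upwards [self_mem_nhdsWithin] with s hs
      simp [abs_of_pos (show (0 : ℝ) < s from hs)]))
  simpa using h2

lemma isBigO_of_le_analyticOrderAt {g : ℂ → ℂ} (hg : AnalyticAt ℂ g 0) {m : ℕ}
    (h : (m : ℕ∞) ≤ analyticOrderAt g 0) : g =O[𝓝 0] fun t => ‖t‖ ^ m := by
  obtain ⟨q, hq, hgq⟩ := (natCast_le_analyticOrderAt hg).1 h
  have h1 : (fun t : ℂ => t ^ m * q t) =O[𝓝 0] fun t => ‖t‖ ^ m * (1 : ℝ) :=
    (IsBigO.of_norm_left (by simpa using isBigO_refl _ _)).mul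
      (hq.continuousAt.tendsto.isBigO_one ℝ)
  refine (h1.congr' ?_ (by simp))
  filter_upwards [hgq] with t ht
  simp [ht]

/-- If the sum of the real part of a holomorphic germ `H` and a nonnegative function `S` vanishes to
order `m`, there is no cancellation between them: along the rays on which the leading term of `H`
is positive, both summands are nonnegative up to higher order. -/
lemma exists_ray_of_re_add_nonneg_isBigO {H : ℂ → ℂ} {S : ℂ → ℝ} (hH : AnalyticAt ℂ H 0)
    (hH0 : H 0 = 0) (hS : ∀ t, 0 ≤ S t) {m : ℕ}
    (h : (fun t => (H t).re + S t) =O[𝓝 0] fun t => ‖t‖ ^ m) :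
    (m : ℕ∞) ≤ analyticOrderAt H 0 ∧
      ∃ u : ℂ, u ≠ 0 ∧ (fun s : ℝ => S (s • u)) =O[𝓝[>] 0] fun s => s ^ m := by
  have hray : ∀ u : ℂ, (fun s : ℝ => (H (s • u)).re + S (s • u)) =O[𝓝[>] 0] fun s => s ^ m := by
    intro u
    refine (h.comp_tendsto (tendsto_smul_nhdsGT u)).trans
      (IsBigO.of_bound (‖u‖ ^ m) (Eventually.of_forall fun s => ?_))
    simp [mul_pow, mul_comm]
  by_cases htop : analyticOrderAt H 0 = ⊤
  · rw [htop]
    refine ⟨le_top, 1, one_ne_zero, (hray 1).congr' ?_ EventuallyEq.rfl⟩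
    filter_upwards [(tendsto_smul_nhdsGT 1).eventually (analyticOrderAt_eq_top.1 htop)] with s hs
    rw [hs, Complex.zero_re, zero_add]
  obtain ⟨k, hk⟩ := ENat.ne_top_iff_exists.1 htop
  obtain ⟨q, hq, hq0, hHq⟩ := (hH.analyticOrderAt_eq_natCast).1 hk.symm
  have hk0 : k ≠ 0 := by
    rintro rfl
    exact (hH.analyticOrderAt_ne_zero.2 hH0) (by simpa using hk.symm)
  -- The ray on which the leading term `q 0 * t ^ k` of `H` is positive.
  obtain ⟨u, hu⟩ := IsAlgClosed.exists_pow_nat_eq (q 0)⁻¹ (Nat.pos_of_ne_zero hk0)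
  have hu0 : u ≠ 0 := by
    rintro rfl
    rw [zero_pow hk0] at hu
    exact inv_ne_zero hq0 hu.symm
  have hre : ∀ᶠ s : ℝ in 𝓝[>] 0, s ^ k / 2 ≤ (H (s • u)).re := by
    have h1 : Tendsto (fun s : ℝ => (u ^ k * q (s • u)).re) (𝓝[>] 0) (𝓝 1) := by
      have h2 : Tendsto (fun s : ℝ => u ^ k * q (s • u)) (𝓝[>] 0) (𝓝 (u ^ k * q 0)) :=
        (hq.continuousAt.tendsto.comp (tendsto_smul_nhdsGT u)).const_mul _
      have h3 : u ^ k * q 0 = 1 := by rw [hu, inv_mul_cancel₀ hq0]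
      rw [h3] at h2
      exact (Complex.continuous_re.tendsto 1).comp h2
    filter_upwards [h1.eventually (lt_mem_nhds one_half_lt_one),
      (tendsto_smul_nhdsGT u).eventually hHq, self_mem_nhdsWithin] with s hs hHs hpos
    have hs0 : (0 : ℝ) < s := hpos
    have h3 : H (s • u) = ((s ^ k : ℝ) : ℂ) * (u ^ k * q (s • u)) := by
      rw [hHs, sub_zero, smul_eq_mul, Complex.real_smul]
      push_cast
      ring
    rw [h3, Complex.re_ofReal_mul]
    have : 0 < s ^ k := by positivity
    nlinarith
  have hpos : ∀ᶠ s : ℝ in 𝓝[>] 0, (0 : ℝ) ≤ s ^ k := by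
    filter_upwards [self_mem_nhdsWithin] with s hs using pow_nonneg (le_of_lt hs) k
  constructor
  · rw [← hk]
    norm_cast
    apply le_of_pow_isBigO_pow
    refine (IsBigO.of_bound 2 ?_).trans (hray u)
    filter_upwards [hre, hpos] with s hs hs0
    have hS0 := hS (s • u)
    rw [Real.norm_of_nonneg hs0, Real.norm_of_nonneg (by linarith)]
    linarith
  · refine ⟨u, hu0, (IsBigO.of_bound 1 ?_).trans (hray u)⟩
    filter_upwards [hre, hpos] with s hs hs0
    have hS0 := hS (s • u)
    rw [Real.norm_of_nonneg hS0, Real.norm_of_nonneg (by linarith)]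
    linarith

/-! ### Divergent substitutions -/

/-- A germ of finite order `p` is the `p`-th power of a local coordinate. -/
lemma exists_pow_eq_of_analyticOrderAt_eq {z : ℂ → ℂ} (hz : AnalyticAt ℂ z 0) {p : ℕ}
    (hp : p ≠ 0) (h : analyticOrderAt z 0 = p) :
    ∃ ζ : ℂ → ℂ, AnalyticAt ℂ ζ 0 ∧ ζ 0 = 0 ∧ deriv ζ 0 ≠ 0 ∧ ∀ᶠ t in 𝓝 0, z t = ζ t ^ p := by
  obtain ⟨q, hq, hq0, hzq⟩ := (hz.analyticOrderAt_eq_natCast).1 h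
  obtain ⟨α, hα⟩ := IsAlgClosed.exists_pow_nat_eq (q 0) (Nat.pos_of_ne_zero hp)
  have hα0 : α ≠ 0 := by
    rintro rfl
    rw [zero_pow hp] at hα
    exact hq0 hα.symm
  set ρ : ℂ → ℂ := fun t => α * (q t / q 0) ^ ((p : ℂ)⁻¹) with hρ
  have hρan : AnalyticAt ℂ ρ 0 := by
    refine analyticAt_const.mul (AnalyticAt.cpow (hq.div analyticAt_const hq0) analyticAt_const ?_)
    simp [hq0]
  have hρ0 : ρ 0 = α := by simp [hρ, hq0]
  have hderiv : HasDerivAt (fun t => t * ρ t) α 0 := by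
    have := (hasDerivAt_id (0 : ℂ)).mul hρan.differentiableAt.hasDerivAt
    simp only [id, one_mul, zero_mul, add_zero, hρ0] at this
    exact this
  refine ⟨fun t => t * ρ t, analyticAt_id.mul hρan, by simp, by rwa [hderiv.deriv], ?_⟩
  filter_upwards [hzq] with t ht
  rw [ht, sub_zero, smul_eq_mul, mul_pow, hρ, mul_pow, Complex.cpow_nat_inv_pow _ hp, hα,
    mul_div_cancel₀ _ hq0]

/-- If a holomorphic germ has the formal expansion `-∑ c_j s ^ (p j)` at the origin, the formal
series `∑ c_j z ^ j` converges at some nonzero point. -/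
lemma exists_summable_of_le_analyticOrderAt {W : ℂ → ℂ} (hW : AnalyticAt ℂ W 0) {c : ℕ → ℂ}
    {p : ℕ} (hp : p ≠ 0)
    (h : ∀ m : ℕ, (m : ℕ∞) ≤
      analyticOrderAt (fun s => W s + ∑ j ∈ Finset.Ico 8 m, c j * s ^ (p * j)) 0) :
    ∃ z : ℂ, z ≠ 0 ∧ Summable fun j : ℕ => c j * z ^ j := by
  have hcoef : ∀ j, 8 ≤ j →
      iteratedDeriv (p * j) W 0 = -(c j * (p * j).factorial) := by
    intro j hj
    set N := p * j with hN
    have han : AnalyticAt ℂ (fun s => ∑ i ∈ Finset.Ico 8 (N + 1), c i * s ^ (p * i)) 0 := by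
      fun_prop
    have h1 := (natCast_le_analyticOrderAt_iff_iteratedDeriv_eq_zero (hW.add han)).1 (h (N + 1)) N
      N.lt_succ_self
    have hNj : j ≤ N := Nat.le_mul_of_pos_left j (Nat.pos_of_ne_zero hp)
    have h2 : iteratedDeriv N (fun s => ∑ i ∈ Finset.Ico 8 (N + 1), c i * s ^ (p * i)) 0 =
        c j * N.factorial := by
      rw [iteratedDeriv_fun_sum (fun i _ => by fun_prop)]
      rw [Finset.sum_eq_single_of_mem j (Finset.mem_Ico.2 ⟨hj, by omega⟩)]
      · rw [iteratedDeriv_const_mul_field, iteratedDeriv_fun_pow_zero]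
        simp [hN]
      · intro i _ hij
        rw [iteratedDeriv_const_mul_field, iteratedDeriv_fun_pow_zero, if_neg, Nat.cast_zero,
          mul_zero]
        exact fun hh => hij (Nat.eq_of_mul_eq_mul_left (Nat.pos_of_ne_zero hp) hh).symm
    rw [iteratedDeriv_add hW.contDiffAt han.contDiffAt, h2] at h1
    exact eq_neg_of_add_eq_zero_left h1
  have hsum := hW.hasFPowerSeriesAt.eventually_hasSum
  obtain ⟨y, hy, hy0⟩ := ((hsum.filter_mono nhdsWithin_le_nhds).and
    (self_mem_nhdsWithin : {0}ᶜ ∈ 𝓝[≠] (0 : ℂ))).exists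
  refine ⟨y ^ p, pow_ne_zero p hy0, ?_⟩
  have hinj : Function.Injective fun j : ℕ => p * j := fun a b hab =>
    Nat.eq_of_mul_eq_mul_left (Nat.pos_of_ne_zero hp) hab
  have h3 := (summable_nat_add_iff 8).2 (hy.summable.comp_injective hinj)
  rw [← summable_nat_add_iff 8]
  refine h3.neg.congr fun j => ?_
  have hfac : (((p * (j + 8)).factorial : ℕ) : ℂ) ≠ 0 := by exact_mod_cast Nat.factorial_ne_zero _
  simp only [Function.comp_apply, FormalMultilinearSeries.ofScalars_apply_eq, smul_eq_mul]
  rw [hcoef _ (by omega), neg_div, mul_div_cancel_right₀ _ hfac, neg_mul, neg_neg, pow_mul]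

/-- The formal relation `w = -∑ c_j z ^ j` between holomorphic germs `z`, `w`, with `z`
nonconstant, forces `∑ c_j z ^ j` to converge somewhere off the origin: write `z` as a power of a
local coordinate, and use this coordinate as the variable of `w`. -/
lemma exists_summable_of_formal_relation {z w : ℂ → ℂ} (hz : AnalyticAt ℂ z 0)
    (hw : AnalyticAt ℂ w 0) (hz0 : z 0 = 0) (hztop : analyticOrderAt z 0 ≠ ⊤) {c : ℕ → ℂ}
    (h : ∀ m : ℕ, (m : ℕ∞) ≤
      analyticOrderAt (fun t => w t + ∑ j ∈ Finset.Ico 8 m, c j * z t ^ j) 0) :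
    ∃ x : ℂ, x ≠ 0 ∧ Summable fun j : ℕ => c j * x ^ j := by
  obtain ⟨p, hp⟩ := ENat.ne_top_iff_exists.1 hztop
  have hp0 : p ≠ 0 := by
    rintro rfl
    exact (hz.analyticOrderAt_ne_zero.2 hz0) (by simpa using hp.symm)
  obtain ⟨ζ, hζ, hζ0, hζ', hpow⟩ := exists_pow_eq_of_analyticOrderAt_eq hz hp0 hp.symm
  set τ := hζ.hasStrictDerivAt.localInverse _ _ _ hζ' with hτdef
  have hτ : AnalyticAt ℂ τ 0 := by
    have := hζ.analyticAt_localInverse hζ'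
    rwa [hζ0] at this
  have hτ0 : τ 0 = 0 := by
    have : τ (ζ 0) = 0 := HasStrictFDerivAt.localInverse_apply_image ..
    rwa [hζ0] at this
  have hright : ∀ᶠ s in 𝓝 0, ζ (τ s) = s := by
    have := HasStrictDerivAt.eventually_right_inverse hζ.hasStrictDerivAt hζ'
    rwa [hζ0] at this
  have hτt : Tendsto τ (𝓝 0) (𝓝 0) := by simpa [hτ0] using hτ.continuousAt.tendsto
  refine exists_summable_of_le_analyticOrderAt (W := w ∘ τ) (c := c)
    ((by rwa [hτ0] : AnalyticAt ℂ w (τ 0)).comp hτ) hp0 fun m => ?_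
  have hg : AnalyticAt ℂ (fun t => w t + ∑ j ∈ Finset.Ico 8 m, c j * z t ^ j) (τ 0) := by
    rw [hτ0]; fun_prop
  have heq : (fun s => (w ∘ τ) s + ∑ j ∈ Finset.Ico 8 m, c j * s ^ (p * j)) =ᶠ[𝓝 0]
      (fun t => w t + ∑ j ∈ Finset.Ico 8 m, c j * z t ^ j) ∘ τ := by
    filter_upwards [hright, hτt.eventually hpow] with s hs hzs
    simp only [Function.comp_apply, hzs, hs, pow_mul]
  rw [analyticOrderAt_congr heq, hg.analyticOrderAt_comp hτ, hτ0]
  refine (h m).trans (le_mul_of_one_le_right zero_le ?_)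
  rw [Order.one_le_iff_ne_zero]
  simpa [hτ0] using hτ.analyticOrderAt_ne_zero.2 hτ0

/-! ### Orders of contact -/

lemma le_vanishingOrder {V W : Type*} [NormedAddCommGroup V] [NormedAddCommGroup W] {h : V → W}
    {m : ℕ} (hm : h =O[𝓝 0] fun x => ‖x‖ ^ m) : (m : ℕ∞) ≤ vanishingOrder h :=
  le_iSup₂ (f := fun (m : ℕ) (_ : h =O[𝓝 0] fun x => ‖x‖ ^ m) => (m : ℕ∞)) m hm

lemma norm_pow_isBigO_norm_pow {V : Type*} [NormedAddCommGroup V] {k m : ℕ} (h : k ≤ m) :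
    (fun x : V => ‖x‖ ^ m) =O[𝓝 0] fun x => ‖x‖ ^ k := by
  refine IsBigO.of_bound 1 ?_
  filter_upwards [Metric.ball_mem_nhds (0 : V) one_pos] with x hx
  rw [one_mul, norm_pow, norm_pow, norm_norm]
  exact pow_le_pow_of_le_one (norm_nonneg x) (by simpa using (Metric.mem_ball.1 hx).le) h

lemma vanishingOrder_le {V W : Type*} [NormedAddCommGroup V] [NormedAddCommGroup W] {h : V → W}
    {k : ℕ} (hk : ¬ h =O[𝓝 0] fun x => ‖x‖ ^ (k + 1)) : vanishingOrder h ≤ k := by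
  refine iSup₂_le fun m hm => ?_
  by_contra! hlt
  exact hk (hm.trans (norm_pow_isBigO_norm_pow (by exact_mod_cast hlt)))

section

variable {n : ℕ} {f : ℂ → ℝ} {c : ℕ → ℝ}

lemma HasTaylorSeriesRe.apply_zero (hT : HasTaylorSeriesRe f c) : f 0 = 0 := by
  obtain ⟨C, hC⟩ := (hT 1).bound
  simpa using hC.self_of_nhds

lemma exampleFunction_comp_isBigO (hn : 2 ≤ n) (hf : ContDiff ℝ ∞ f) (hf0 : f 0 = 0)
    {V : Type*} [NormedAddCommGroup V] {φ : V → Fin (n + 1) → ℂ} (hφ : ContinuousAt φ 0)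
    (hφ0 : φ 0 = 0) {r' : (Fin (n + 1) → ℂ) → ℝ}
    (hr' : IsLocalDefiningFunction {x | exampleFunction n f x = 0} 0 r') {m : ℕ}
    (h : (r' ∘ φ) =O[𝓝 0] fun x => ‖x‖ ^ m) :
    (exampleFunction n f ∘ φ) =O[𝓝 0] fun x => ‖x‖ ^ m := by
  have hφt : Tendsto φ (𝓝 0) (𝓝 0) := by simpa [ContinuousAt, hφ0] using hφ
  exact ((exampleFunction_isBigO_of_isLocalDefiningFunction hn hf hf0 hr').comp_tendsto hφt).trans h

lemma contactOrder_exampleFunction_le (hn : 2 ≤ n) (hf : ContDiff ℝ ∞ f) (hf0 : f 0 = 0)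
    {V : Type*} [NormedAddCommGroup V] {φ : V → Fin (n + 1) → ℂ} (hφ : ContinuousAt φ 0)
    (hφ0 : φ 0 = 0) {k : ℕ}
    (h : ¬ (exampleFunction n f ∘ φ) =O[𝓝 0] fun x => ‖x‖ ^ (k + 1)) :
    contactOrder {x | exampleFunction n f x = 0} 0 φ ≤ k :=
  iSup₂_le fun _ hr' => vanishingOrder_le fun h' =>
    h (exampleFunction_comp_isBigO hn hf hf0 hφ hφ0 hr' h')

/-- A curve has high order of contact with the hypersurface only if its components satisfy the
equations `z₁ ^ 3 = z₂ ^ 2`, `z_j = 0` and `w = -∑ c_j z₁ ^ j` to high order. -/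
lemma le_analyticOrderAt_of_exampleFunction_comp_isBigO (hT : HasTaylorSeriesRe f c)
    {γ : ℂ → Fin (n + 1) → ℂ} (hγ : AnalyticAt ℂ γ 0) (hγ0 : γ 0 = 0) {m : ℕ}
    (h : (exampleFunction n f ∘ γ) =O[𝓝 0] fun t => ‖t‖ ^ m) :
    (m : ℕ∞) ≤ analyticOrderAt
        (fun t => γ t (Fin.last n) + ∑ j ∈ Finset.Ico 8 m, (c j : ℂ) * γ t 0 ^ j) 0 ∧
      (m : ℕ∞) ≤ 2 * analyticOrderAt (fun t => γ t 0 ^ 3 - γ t 1 ^ 2) 0 ∧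
      ∀ j : Fin (n + 1), 2 ≤ j.val → j.val < n →
        (m : ℕ∞) ≤ 2 * analyticOrderAt (fun t => γ t j) 0 := by
  have hc : ∀ j, AnalyticAt ℂ (fun t => γ t j) 0 := analyticAt_pi_iff.1 hγ
  have hc0 : ∀ j, γ 0 j = 0 := fun j => by rw [hγ0]; rfl
  set H : ℂ → ℂ := fun t => γ t (Fin.last n) + ∑ j ∈ Finset.Ico 8 m, (c j : ℂ) * γ t 0 ^ j with hH
  set T : ℂ → ℝ := fun t => ∑ j : Fin (n + 1), if 2 ≤ j.val ∧ j.val < n then ‖γ t j‖ ^ 2 else 0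
    with hTdef
  set S : ℂ → ℝ := fun t => (1 / 2) * (‖γ t 0 ^ 3 - γ t 1 ^ 2‖ ^ 2 + T t) with hS
  have hterm : ∀ t, ∀ j : Fin (n + 1),
      0 ≤ if 2 ≤ j.val ∧ j.val < n then ‖γ t j‖ ^ 2 else (0 : ℝ) := by
    intro t j
    split_ifs <;> positivity
  have hT0 : ∀ t, 0 ≤ T t := fun t => Finset.sum_nonneg fun j _ => hterm t j
  have hHan : AnalyticAt ℂ H 0 :=
    (hc _).add (Finset.analyticAt_fun_sum _ fun j _ => analyticAt_const.mul ((hc 0).pow j))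
  have hH0 : H 0 = 0 := by
    simp only [hH, hc0, zero_add]
    refine Finset.sum_eq_zero fun j hj => ?_
    rw [zero_pow (by have := (Finset.mem_Ico.1 hj).1; omega), mul_zero]
  have h0t : Tendsto (fun t => γ t 0) (𝓝 0) (𝓝 0) := by
    simpa [hc0] using (hc 0).continuousAt.tendsto
  have h0O : (fun t => γ t 0) =O[𝓝 0] fun t => ‖t‖ ^ 1 :=
    isBigO_of_le_analyticOrderAt (hc 0)
      (by exact_mod_cast Order.one_le_iff_ne_zero.2 ((hc 0).analyticOrderAt_ne_zero.2 (hc0 0)))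
  have hf : (fun t => f (γ t 0) - 2 * ∑ j ∈ Finset.Ico 8 m, ((c j : ℂ) * γ t 0 ^ j).re)
      =O[𝓝 0] fun t => ‖t‖ ^ m := by
    refine ((hT m).comp_tendsto h0t).trans ?_
    simpa [Function.comp_def] using! h0O.norm_left.pow m
  have hHS : (fun t => (H t).re + S t) =O[𝓝 0] fun t => ‖t‖ ^ m := by
    refine ((h.sub hf).const_mul_left (1 / 2)).congr_left fun t => ?_
    simp only [hH, hS, hTdef, Function.comp_apply, exampleFunction, Complex.add_re, Complex.re_sum]
    ring
  obtain ⟨h1, u, hu, hSu⟩ := exists_ray_of_re_add_nonneg_isBigO hHan hH0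
    (fun t => by have := hT0 t; positivity) hHS
  have hle : ∀ g : ℂ → ℂ, AnalyticAt ℂ g 0 → (∀ t, ‖g t‖ ^ 2 ≤ 2 * S t) →
      (m : ℕ∞) ≤ 2 * analyticOrderAt g 0 := by
    intro g hg hgS
    refine le_mul_analyticOrderAt_of_isBigO_ray hg hu two_ne_zero
      ((IsBigO.of_bound 2 (Eventually.of_forall fun s => ?_)).trans hSu)
    rw [Real.norm_of_nonneg (by positivity), Real.norm_eq_abs]
    exact (hgS _).trans (by gcongr; exact le_abs_self _)
  refine ⟨h1, hle _ (((hc 0).pow 3).sub ((hc 1).pow 2)) fun t => ?_,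
    fun j hj2 hjn => hle _ (hc j) fun t => ?_⟩
  · have := hT0 t
    simp only [hS]
    linarith
  · have h2 : ‖γ t j‖ ^ 2 ≤ T t := by
      have := Finset.single_le_sum (fun i _ => hterm t i) (Finset.mem_univ j)
      rwa [if_pos ⟨hj2, hjn⟩] at this
    have : 0 ≤ ‖γ t 0 ^ 3 - γ t 1 ^ 2‖ ^ 2 := by positivity
    simp only [hS]
    linarith

lemma eq_zero_or_eq_one_or_middle_or_eq_last (j : Fin (n + 1)) :
    j = 0 ∨ j = 1 ∨ (2 ≤ j.val ∧ j.val < n) ∨ j = Fin.last n := by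
  by_cases h0 : j.val = 0
  · exact Or.inl (Fin.ext (by simpa using h0))
  by_cases h1 : j.val = 1
  · refine Or.inr (Or.inl (Fin.ext ?_))
    rw [h1, Fin.val_one', Nat.mod_eq_of_lt (by omega)]
  by_cases h2 : j.val < n
  · exact Or.inr (Or.inr (Or.inl ⟨by omega, h2⟩))
  · exact Or.inr (Or.inr (Or.inr (Fin.ext (by rw [Fin.val_last]; omega))))

/-- Contact of order `8` forces a curve to be singular: the cusp `z₁ ^ 3 = z₂ ^ 2` contains no
regular curve, and the Taylor series of `f` starts with `c_8 z ^ 8`. -/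
lemma isBigO_sq_of_exampleFunction_comp_isBigO (hT : HasTaylorSeriesRe f c)
    {γ : ℂ → Fin (n + 1) → ℂ} (hγ : AnalyticAt ℂ γ 0) (hγ0 : γ 0 = 0)
    (h : (exampleFunction n f ∘ γ) =O[𝓝 0] fun t => ‖t‖ ^ 8) : γ =O[𝓝 0] fun t => ‖t‖ ^ 2 := by
  have hc : ∀ j, AnalyticAt ℂ (fun t => γ t j) 0 := analyticAt_pi_iff.1 hγ
  have hc0 : ∀ j, γ 0 j = 0 := fun j => by rw [hγ0]; rfl
  obtain ⟨hw, hA, hj⟩ := le_analyticOrderAt_of_exampleFunction_comp_isBigO hT hγ hγ0 h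
  -- `⌈m / k⌉` is a lower bound for `a` if `m ≤ k * a`.
  have half : ∀ {a : ℕ∞} {k m : ℕ}, (m : ℕ∞) ≤ (k : ℕ∞) * a → ∀ l : ℕ, k * l < m + k →
      (l : ℕ∞) ≤ a := by
    intro a k m hm l hl
    induction a using ENat.recTopCoe with
    | top => exact le_top
    | coe a =>
      norm_cast at hm ⊢
      by_contra! hal
      have := Nat.mul_le_mul_left k (Nat.succ_le_of_lt hal)
      rw [Nat.mul_succ] at this
      omega
  have hA4 : ((4 : ℕ) : ℕ∞) ≤ analyticOrderAt (fun t => γ t 0 ^ 3 - γ t 1 ^ 2) 0 :=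
    half hA 4 (by norm_num)
  have hz1 : (1 : ℕ∞) ≤ analyticOrderAt (fun t => γ t 0) 0 :=
    Order.one_le_iff_ne_zero.2 ((hc 0).analyticOrderAt_ne_zero.2 (hc0 0))
  have hA' : AnalyticAt ℂ (fun t => γ t 0 ^ 3 - γ t 1 ^ 2) 0 := ((hc 0).pow 3).sub ((hc 1).pow 2)
  -- `z₂ ^ 2` has order at least `3`, hence `z₂` has order at least `2`.
  have hz2 : ((2 : ℕ) : ℕ∞) ≤ analyticOrderAt (fun t => γ t 1) 0 := by
    refine half (k := 2) (m := 3) ?_ 2 (by norm_num)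
    have h1 := analyticOrderAt_pow (hc 1) 2
    rw [nsmul_eq_mul] at h1
    rw [← h1]
    have h2 : (fun t => γ t 1) ^ 2 = (fun t => γ t 0) ^ 3 - fun t => γ t 0 ^ 3 - γ t 1 ^ 2 := by
      ext t; simp
    rw [h2]
    refine le_trans (le_min ?_ (le_trans (by norm_num) hA4)) le_analyticOrderAt_sub
    rw [analyticOrderAt_pow (hc 0), nsmul_eq_mul]
    exact le_mul_of_one_le_right zero_le hz1
  -- Now `z₁ ^ 3` has order at least `4`, hence `z₁` has order at least `2`.
  have hz1' : ((2 : ℕ) : ℕ∞) ≤ analyticOrderAt (fun t => γ t 0) 0 := by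
    refine half (k := 3) (m := 4) ?_ 2 (by norm_num)
    have h1 := analyticOrderAt_pow (hc 0) 3
    rw [nsmul_eq_mul] at h1
    rw [← h1]
    have h2 : (fun t => γ t 0) ^ 3 = (fun t => γ t 0 ^ 3 - γ t 1 ^ 2) + (fun t => γ t 1) ^ 2 := by
      ext t; simp
    rw [h2]
    refine le_trans (le_min hA4 ?_) le_analyticOrderAt_add
    rw [analyticOrderAt_pow (hc 1), nsmul_eq_mul]
    calc ((4 : ℕ) : ℕ∞) = 2 * (2 : ℕ) := by norm_num
      _ ≤ _ := by gcongr; norm_num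
  rw [isBigO_pi]
  intro j
  refine isBigO_of_le_analyticOrderAt (hc j) ?_
  rcases eq_zero_or_eq_one_or_middle_or_eq_last j with rfl | rfl | ⟨h2, hjn⟩ | rfl
  · exact hz1'
  · exact hz2
  · exact half (hj j h2 hjn) 2 (by norm_num)
  · simp only [Finset.Ico_self, Finset.sum_empty, add_zero] at hw
    exact le_trans (by norm_num) hw

lemma regularType_le (hn : 2 ≤ n) (hf : ContDiff ℝ ∞ f) (hT : HasTaylorSeriesRe f c) :
    regularType {x | exampleFunction n f x = 0} 0 ≤ (7 : ℕ) := by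
  refine iSup₂_le fun γ hγ => ?_
  obtain ⟨⟨hγ, hγ0, -⟩, hord⟩ := hγ
  refine contactOrder_exampleFunction_le hn hf hT.apply_zero hγ.continuousAt hγ0 fun h => ?_
  have h2 := le_vanishingOrder (isBigO_sq_of_exampleFunction_comp_isBigO hT hγ hγ0 h)
  simp only [sub_zero] at hord
  have h3 : vanishingOrder γ = 1 := hord
  rw [h3] at h2
  norm_num at h2

/-- The restriction of an immersion to a complex line is a regular curve. -/
lemma bloomGrahamType_le (hn : 2 ≤ n) (hf : ContDiff ℝ ∞ f) (hT : HasTaylorSeriesRe f c) :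
    bloomGrahamType {x | exampleFunction n f x = 0} 0 ≤ (7 : ℕ) := by
  refine iSup₂_le fun φ hφ => ?_
  obtain ⟨hφ, hφ0, hinj⟩ := hφ
  refine contactOrder_exampleFunction_le hn hf hT.apply_zero hφ.continuousAt hφ0 fun h => ?_
  set v : Fin n → ℂ := fun _ => 1 with hv
  have hv0 : v ≠ 0 := fun h0 => one_ne_zero (congrFun h0 ⟨0, by omega⟩)
  have hline : AnalyticAt ℂ (fun t : ℂ => t • v) 0 := by fun_prop
  have hφ' : AnalyticAt ℂ φ ((0 : ℂ) • v) := by rwa [zero_smul]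
  have hγ : AnalyticAt ℂ (fun t : ℂ => φ (t • v)) 0 :=
    AnalyticAt.comp (f := fun t : ℂ => t • v) (x := 0) hφ' hline
  have hlt : Tendsto (fun t : ℂ => t • v) (𝓝 0) (𝓝 0) := by
    simpa using hline.continuousAt.tendsto
  have hO : (exampleFunction n f ∘ fun t : ℂ => φ (t • v)) =O[𝓝 0] fun t => ‖t‖ ^ 8 := by
    refine (h.comp_tendsto hlt).trans
      (IsBigO.of_bound (‖v‖ ^ 8) (Eventually.of_forall fun t => ?_))
    simp only [Function.comp_apply, norm_smul, mul_pow, norm_mul, norm_pow, norm_norm]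
    rw [mul_comm]
  have hsq := isBigO_sq_of_exampleFunction_comp_isBigO hT hγ (by simpa using hφ0) hO
  have hd0 : HasDerivAt (fun t : ℂ => φ (t • v)) 0 0 := by
    rw [hasDerivAt_iff_isLittleO]
    have : (fun t : ℂ => ‖t‖ ^ 2) =o[𝓝 0] fun t : ℂ => t := by
      simpa using! (isLittleO_norm_pow_id (E' := ℂ) one_lt_two)
    simpa [hφ0] using hsq.trans_isLittleO this
  have hd : HasDerivAt (fun t : ℂ => φ (t • v)) (fderiv ℂ φ 0 v) 0 := by
    have h1 : HasDerivAt (fun t : ℂ => t • v) v 0 := by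
      simpa using (hasDerivAt_id (0 : ℂ)).smul_const v
    have h2 : HasFDerivAt φ (fderiv ℂ φ 0) ((0 : ℂ) • v) := by
      rw [zero_smul]; exact hφ.differentiableAt.hasFDerivAt
    exact h2.comp_hasDerivAt 0 h1
  exact hv0 (hinj ((hd.unique hd0).trans (map_zero _).symm))

/-- A curve tangent to infinite order lies on the cusp `z₁ ^ 3 = z₂ ^ 2` and satisfies
`w = -∑ c_j z₁ ^ j` formally, which is impossible for a divergent series. -/
lemma not_isTangentToInfiniteOrder (hn : 2 ≤ n) (hf : ContDiff ℝ ∞ f)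
    (hT : HasTaylorSeriesRe f c)
    (hdiv : ∀ z : ℂ, z ≠ 0 → ¬ Summable fun j : ℕ => (c j : ℂ) * z ^ j)
    {γ : ℂ → Fin (n + 1) → ℂ} (hγ : γ ∈ holomorphicCurves (0 : Fin (n + 1) → ℂ)) :
    ¬ IsTangentToInfiniteOrder {x | exampleFunction n f x = 0} 0 γ := by
  obtain ⟨hγ, hγ0, hconst⟩ := hγ
  rintro ⟨r', hr', hO⟩
  have hc : ∀ j, AnalyticAt ℂ (fun t => γ t j) 0 := analyticAt_pi_iff.1 hγ
  have hc0 : ∀ j, γ 0 j = 0 := fun j => by rw [hγ0]; rfl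
  have hall := fun m => le_analyticOrderAt_of_exampleFunction_comp_isBigO hT hγ hγ0
    (exampleFunction_comp_isBigO hn hf hT.apply_zero hγ.continuousAt hγ0 hr' (hO m))
  have htop : ∀ a : ℕ∞, (∀ m : ℕ, (m : ℕ∞) ≤ 2 * a) → a = ⊤ := by
    intro a ha
    by_contra hne
    obtain ⟨k, rfl⟩ := ENat.ne_top_iff_exists.1 hne
    have := ha (2 * k + 1)
    norm_cast at this
    omega
  by_cases hz : analyticOrderAt (fun t => γ t 0) 0 = ⊤
  · have hz0 := analyticOrderAt_eq_top.1 hz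
    have hA := analyticOrderAt_eq_top.1 (htop _ fun m => (hall m).2.1)
    have hw : analyticOrderAt (fun t => γ t (Fin.last n)) 0 = ⊤ := by
      refine htop _ fun m => (hall m).1.trans ?_
      refine le_trans (le_of_eq (analyticOrderAt_congr ?_))
        (le_mul_of_one_le_left zero_le (by norm_num))
      filter_upwards [hz0] with t ht
      rw [ht, Finset.sum_eq_zero, add_zero]
      intro j hj
      rw [zero_pow (by have := (Finset.mem_Ico.1 hj).1; omega), mul_zero]
    have hcoord : ∀ j, ∀ᶠ t in 𝓝 0, γ t j = 0 := by
      intro j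
      rcases eq_zero_or_eq_one_or_middle_or_eq_last j with rfl | rfl | ⟨h2, hjn⟩ | rfl
      · exact hz0
      · filter_upwards [hz0, hA] with t h0 h1
        simpa [h0] using h1
      · exact analyticOrderAt_eq_top.1 (htop _ fun m => (hall m).2.2 j h2 hjn)
      · exact analyticOrderAt_eq_top.1 hw
    exact hconst ((eventually_all.2 hcoord).mono fun t ht => funext ht)
  · obtain ⟨x, hx, hsum⟩ := exists_summable_of_formal_relation (hc 0) (hc (Fin.last n)) (hc0 0) hz
      (c := fun j => (c j : ℂ)) fun m => (hall m).1
    exact hdiv x hx hsum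

/-- The curve `t ↦ (t ^ 2, t ^ 3, 0, …, 0, -∑_{8 ≤ j < m} c_j t ^ (2 j))`. -/
noncomputable def cuspCurve (n : ℕ) (c : ℕ → ℝ) (m : ℕ) (t : ℂ) (j : Fin (n + 1)) : ℂ :=
  if j = Fin.last n then -∑ i ∈ Finset.Ico 8 m, (c i : ℂ) * (t ^ 2) ^ i
  else if j = 0 then t ^ 2 else if j = 1 then t ^ 3 else 0

lemma cuspCurve_zero (hn : 2 ≤ n) (m : ℕ) (t : ℂ) : cuspCurve n c m t 0 = t ^ 2 := by
  have h0 : (0 : Fin (n + 1)) ≠ Fin.last n := by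
    simp only [ne_eq, Fin.ext_iff, Fin.val_zero, Fin.val_last]; omega
  simp [cuspCurve, h0]

lemma analyticAt_cuspCurve (m : ℕ) : AnalyticAt ℂ (cuspCurve n c m) 0 := by
  rw [analyticAt_pi_iff]
  intro j
  unfold cuspCurve
  split_ifs <;> fun_prop

lemma not_cuspCurve_isBigO (hn : 2 ≤ n) (m : ℕ) :
    ¬ cuspCurve n c m =O[𝓝 0] fun t => ‖t‖ ^ 3 := by
  intro h
  have h1 := isBigO_pi.1 h 0
  simp only [cuspCurve_zero hn] at h1
  have h2 := le_analyticOrderAt_of_isBigO (by fun_prop) h1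
  have h3 := analyticOrderAt_centeredMonomial (𝕜 := ℂ) (z₀ := 0) (n := 2)
  simp only [sub_zero] at h3
  have h4 : analyticOrderAt (fun t : ℂ => t ^ 2) 0 = (2 : ℕ) := h3
  rw [h4] at h2
  norm_num at h2

lemma exampleFunction_cuspCurve (hn : 2 ≤ n) (m : ℕ) (t : ℂ) :
    exampleFunction n f (cuspCurve n c m t) =
      f (t ^ 2) - 2 * ∑ j ∈ Finset.Ico 8 m, ((c j : ℂ) * (t ^ 2) ^ j).re := by
  have h1 : (1 : Fin (n + 1)) ≠ Fin.last n := by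
    simp only [ne_eq, Fin.ext_iff, Fin.val_one', Fin.val_last]
    rw [Nat.mod_eq_of_lt (by omega)]; omega
  have h10 : (1 : Fin (n + 1)) ≠ 0 := by
    simp only [ne_eq, Fin.ext_iff, Fin.val_one', Fin.val_zero]
    rw [Nat.mod_eq_of_lt (by omega)]; omega
  have hw : cuspCurve n c m t (Fin.last n) = -∑ i ∈ Finset.Ico 8 m, (c i : ℂ) * (t ^ 2) ^ i := by
    simp [cuspCurve]
  have hz2 : cuspCurve n c m t 1 = t ^ 3 := by simp [cuspCurve, h1, h10]
  have hsum : (∑ j : Fin (n + 1), if 2 ≤ j.val ∧ j.val < n then ‖cuspCurve n c m t j‖ ^ 2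
      else 0) = 0 := by
    refine Finset.sum_eq_zero fun j _ => ?_
    split_ifs with hj
    · have hjl : j ≠ Fin.last n := by
        simp only [ne_eq, Fin.ext_iff, Fin.val_last]; omega
      have hj0 : j ≠ 0 := by
        simp only [ne_eq, Fin.ext_iff, Fin.val_zero]; omega
      have hj1 : j ≠ 1 := by
        simp only [ne_eq, Fin.ext_iff, Fin.val_one']
        rw [Nat.mod_eq_of_lt (by omega)]; omega
      simp [cuspCurve, hjl, hj0, hj1]
    · rfl
  rw [exampleFunction, hsum, hw, hz2, cuspCurve_zero hn, Complex.neg_re, Complex.re_sum]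
  have : ‖(t ^ 2) ^ 3 - (t ^ 3) ^ 2‖ ^ 2 = 0 := by
    rw [← pow_mul, ← pow_mul, sub_self]; simp
  rw [this]
  ring

/-- The cusp curves have multiplicity `2` and arbitrarily high order of contact. -/
lemma dangeloType_eq_top (hn : 2 ≤ n) (hf : ContDiff ℝ ∞ f) (hT : HasTaylorSeriesRe f c) :
    dangeloType {x | exampleFunction n f x = 0} 0 = ⊤ := by
  have key : ∀ m : ℕ, (m : ℝ≥0∞) ≤ dangeloType {x | exampleFunction n f x = 0} 0 := by
    intro m
    set γ := cuspCurve n c m with hγdef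
    have hγ0 : γ 0 = 0 := by
      ext j
      simp only [hγdef, cuspCurve, Pi.zero_apply]
      split_ifs
      · rw [neg_eq_zero]
        refine Finset.sum_eq_zero fun i hi => ?_
        rw [zero_pow two_ne_zero, zero_pow (by have := (Finset.mem_Ico.1 hi).1; omega), mul_zero]
      all_goals simp
    have hnot := not_cuspCurve_isBigO (c := c) hn m
    have hmem : γ ∈ holomorphicCurves (0 : Fin (n + 1) → ℂ) := by
      refine ⟨analyticAt_cuspCurve m, hγ0, fun hev => hnot ?_⟩
      exact (isBigO_zero _ _).congr' (hev.mono fun t ht => ht.symm) EventuallyEq.rfl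
    have hord : vanishingOrder (fun t => γ t - 0) ≤ (2 : ℕ) := by
      simp only [sub_zero]
      exact vanishingOrder_le hnot
    have hcontact : ((2 * m : ℕ) : ℕ∞) ≤ contactOrder {x | exampleFunction n f x = 0} 0 γ := by
      have hsq : Tendsto (fun t : ℂ => t ^ 2) (𝓝 0) (𝓝 0) := by
        have : Continuous fun t : ℂ => t ^ 2 := by fun_prop
        simpa using this.tendsto 0
      have hO : (exampleFunction n f ∘ γ) =O[𝓝 0] fun t => ‖t‖ ^ (2 * m) := by
        have h1 := (hT m).comp_tendsto hsq
        refine (h1.congr (fun t => ?_) fun t => ?_)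
        · simp only [Function.comp_apply, hγdef, exampleFunction_cuspCurve hn]
        · simp only [Function.comp_apply, norm_pow, pow_mul]
      refine (le_vanishingOrder hO).trans ?_
      exact le_iSup₂ (f := fun (r : (Fin (n + 1) → ℂ) → ℝ)
        (_ : IsLocalDefiningFunction {x | exampleFunction n f x = 0} 0 r) =>
          vanishingOrder (r ∘ γ)) (exampleFunction n f)
        ⟨Set.univ, Set.mem_univ _, isDefiningFunction_exampleFunction hn hf⟩
    calc (m : ℝ≥0∞) = ((2 * m : ℕ) : ℝ≥0∞) / ((2 : ℕ) : ℝ≥0∞) := by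
          rw [Nat.cast_mul, mul_comm]
          exact (ENNReal.mul_div_cancel_right (by norm_num) (by norm_num)).symm
      _ ≤ ((contactOrder {x | exampleFunction n f x = 0} 0 γ : ℕ∞) : ℝ≥0∞) /
            ((vanishingOrder fun t => γ t - 0 : ℕ∞) : ℝ≥0∞) := by
          refine ENNReal.div_le_div ?_ ?_
          · exact_mod_cast ENat.toENNReal_le.2 hcontact
          · exact_mod_cast ENat.toENNReal_le.2 hord
      _ ≤ _ := le_iSup₂ (f := fun (γ : ℂ → Fin (n + 1) → ℂ)
          (_ : γ ∈ holomorphicCurves (0 : Fin (n + 1) → ℂ)) =>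
          ((contactOrder {x | exampleFunction n f x = 0} 0 γ : ℕ∞) : ℝ≥0∞) /
            ((vanishingOrder fun t => γ t - 0 : ℕ∞) : ℝ≥0∞)) γ hmem
  exact ENNReal.eq_top_of_forall_nnreal_le fun r => by
    obtain ⟨m, hm⟩ := exists_nat_ge r
    exact le_trans (by exact_mod_cast hm) (key m)

end

theorem theorem6p6 (n : ℕ) (hn : 2 ≤ n) :
    ∃ (c : ℕ → ℝ) (f : ℂ → ℝ) (M : Set (Fin (n + 1) → ℂ)),
      (∀ j, 0 < c j) ∧ StrictMono c ∧
      (∀ z : ℂ, z ≠ 0 → ¬ Summable fun j : ℕ => (c j : ℂ) * z ^ j) ∧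
      IsSmoothSubharmonic f ∧ HasTaylorSeriesRe f c ∧
      M = {x | exampleFunction n f x = 0} ∧ (0 : Fin (n + 1) → ℂ) ∈ M ∧
      IsSmoothRealHypersurface M ∧ IsPseudoconvexHypersurface M ∧
      dangeloType M 0 = ⊤ ∧ regularType M 0 < ⊤ ∧ bloomGrahamType M 0 < ⊤ ∧
      ¬ ∃ γ ∈ holomorphicCurves (0 : Fin (n + 1) → ℂ), IsTangentToInfiniteOrder M 0 γ := by
  obtain ⟨f, hf, hT⟩ := exists_subharmonic_hasTaylorSeriesRe
  refine ⟨coeff, f, {x | exampleFunction n f x = 0}, coeff_pos, strictMono_coeff,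
    fun z hz => not_summable_coeff_mul_pow hz, hf, hT, rfl, exampleFunction_zero hT.apply_zero,
    fun p _ => ⟨exampleFunction n f, Set.univ, Set.mem_univ p,
      isDefiningFunction_exampleFunction hn hf.1⟩,
    isPseudoconvexHypersurface_exampleFunction hn hf, dangeloType_eq_top hn hf.1 hT,
    (regularType_le hn hf.1 hT).trans_lt (ENat.natCast_lt_top 7),
    (bloomGrahamType_le hn hf.1 hT).trans_lt (ENat.natCast_lt_top 7), ?_⟩
  rintro ⟨γ, hγ, htan⟩
  exact not_isTangentToInfiniteOrder hn hf.1 hT (fun z hz => not_summable_coeff_mul_pow hz) hγ htan
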